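/- Let $N\ge 2$ and $2^*=\frac{2N}{N-1}$. Write points of $\mathbb{R}^{N+1}_+=\{(x,y):x\in\mathbb{R}^N,\ y>0\}$ as $(x,y)$, and let $$\mathcal{H}(\mathbb{R}^{N+1}_+)=\Big\{v\in H^1(\mathbb{R}^{N+1}_+):\ \iint_{\mathbb{R}^{N+1}_+}\big[|\nabla v|^2+|x|^2v^2\big]\,dx\,dy<\infty\Big\}$$ (real-valued functions). For $v\in H^1(\mathbb{R}^{N+1}_+)$ let $v(\cdot,0)$ denote its trace on $\mathbb{R}^N\cong\partial\mathbb{R}^{N+1}_+$. Let $f\in C^1(\mathbb{R}^N\times\mathbb{R};\mathbb{R})$ satisfy - $(f_1)$ $\displaystyle\lim_{t\to0}\frac{|f(x,t)|}{t}=0$ uniformly in $x\in\mathbb{R}^N$; - $(f_2)$ $\displaystyle\lim_{|t|\to\infty}\frac{|f(x,t)|}{|t|^{\theta-1}}=0$ uniformly in $x\in\mathbb{R}^N$, for some $\theta$ with $2<\theta<2^*$. Let $v\in\mathcal{H}(\mathbb{R}^{N+1}_+)$ be a weak solution of $$-\Delta v+|x|^2v=0\ \text{ in }\mathbb{R}^{N+1}_+,\qquad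 -\frac{\partial v}{\partial y}(x,0)=f(x,v(x,0))\ \text{ on }\mathbb{R}^N,$$ that is, for every $\varphi\in\mathcal{H}(\mathbb{R}^{N+1}_+)$ the function $x\mapsto f(x,v(x,0))\,\varphi(x,0)$ is integrable on $\mathbb{R}^N$ and $$\iint_{\mathbb{R}^{N+1}_+}\big[\nabla v\cdot\nabla\varphi+|x|^2v\varphi\big]\,dx\,dy=\int_{\mathbb{R}^N}f(x,v(x,0))\,\varphi(x,0)\,dx .$$ Then the trace of $v$ satisfies $v(\cdot,0)\in L^p(\mathbb{R}^N)$ for every $p\in[2,\infty]$. -/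

import Mathlib

open MeasureTheory Filter Topology
open scoped ENNReal ContDiff

namespace HarmonicExtension

/-- Points of `ℝ^{N+1} = ℝ^N × ℝ`, written `(x, y)`. The measure on it is the product Lebesgue
measure `dx dy`. -/
abbrev Pt (N : ℕ) : Type := EuclideanSpace ℝ (Fin N) × ℝ

/-- Values of gradients `(∇ₓ v, ∂_y v)`: the space `ℝ^N × ℝ` with the Euclidean inner product
and norm. -/
abbrev Vec (N : ℕ) : Type := WithLp 2 (EuclideanSpace ℝ (Fin N) × ℝ)

/-- The open upper half-space `{(x, y) : y > 0}`. -/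
def halfSpace (N : ℕ) : Set (Pt N) := {z | 0 < z.2}

/-- Lebesgue measure on the upper half-space. -/
noncomputable def halfMeasure (N : ℕ) : Measure (Pt N) :=
  (volume : Measure (Pt N)).restrict (halfSpace N)

/-- The classical gradient `(∇ₓ φ, ∂_y φ)` of a differentiable function. -/
noncomputable def classicalGrad {N : ℕ} (φ : Pt N → ℝ) (z : Pt N) : Vec N :=
  WithLp.toLp 2 (gradient (fun x => φ (x, z.2)) z.1, deriv (fun y => φ (z.1, y)) z.2)

/-- `G` is a weak gradient of `v` in the open half-space, and both are square integrable there.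
So `v ∈ H¹` of the half-space if and only if such a `G` exists (and then `G` is unique a.e.). -/
structure IsWeakGrad {N : ℕ} (v : Pt N → ℝ) (G : Pt N → Vec N) : Prop where
  memLp_fun : MemLp v 2 (halfMeasure N)
  memLp_grad : MemLp G 2 (halfMeasure N)
  integral_eq : ∀ φ : Pt N → ℝ, ContDiff ℝ ∞ φ → HasCompactSupport φ →
    tsupport φ ⊆ halfSpace N →
    ∫ z, v z • classicalGrad φ z ∂(halfMeasure N) = - ∫ z, φ z • G z ∂(halfMeasure N)

/-- The weighted Sobolev space: `v ∈ H¹` of the half-space with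
`∬ |∇v|² + |x|² v² dx dy < ∞`. -/
def MemH {N : ℕ} (v : Pt N → ℝ) : Prop :=
  ∃ G : Pt N → Vec N, IsWeakGrad v G ∧
    Integrable (fun z : Pt N => ‖G z‖ ^ 2 + ‖z.1‖ ^ 2 * (v z) ^ 2) (halfMeasure N)

/-- `u` is (a representative of) the trace `v(·, 0)` of the `H¹` function `v`: restriction to
`y = 0` of functions in `C_c^∞(ℝ^{N+1})`, extended by continuity from the `H¹` norm on the
half-space to the `L²` norm on `ℝ^N`. -/
def IsTrace {N : ℕ} (v : Pt N → ℝ) (u : EuclideanSpace ℝ (Fin N) → ℝ) : Prop :=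
  AEStronglyMeasurable u volume ∧
  ∃ G : Pt N → Vec N, IsWeakGrad v G ∧
  ∃ w : ℕ → Pt N → ℝ, (∀ n, ContDiff ℝ ∞ (w n) ∧ HasCompactSupport (w n)) ∧
    Tendsto (fun n => eLpNorm (fun z => w n z - v z) 2 (halfMeasure N)) atTop (𝓝 0) ∧
    Tendsto (fun n => eLpNorm (fun z => classicalGrad (w n) z - G z) 2 (halfMeasure N))
      atTop (𝓝 0) ∧
    Tendsto (fun n => eLpNorm (fun x => w n (x, 0) - u x) 2 volume) atTop (𝓝 0)

/-- Weak solutions of `-Δv + |x|² v = 0` in the half-space, `-∂_y v(x,0) = f(x, v(x,0))` on its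
boundary: `v` lies in the weighted space and, for every test function `φ` in it,
`∬ ∇v·∇φ + |x|² v φ dx dy = ∫ f(x, v(x,0)) φ(x,0) dx`, the right-hand integral being absolutely
convergent (the left-hand one always is). Gradients and traces are determined up to null sets;
here the identity is asked for all their representatives. -/
def IsWeakSolution {N : ℕ} (f : EuclideanSpace ℝ (Fin N) → ℝ → ℝ) (v : Pt N → ℝ) : Prop :=
  MemH v ∧
  ∀ (G : Pt N → Vec N) (u : EuclideanSpace ℝ (Fin N) → ℝ), IsWeakGrad v G → IsTrace v u →
  ∀ (φ : Pt N → ℝ) (Φ : Pt N → Vec N) (τ : EuclideanSpace ℝ (Fin N) → ℝ),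
    MemH φ → IsWeakGrad φ Φ → IsTrace φ τ →
    Integrable (fun x => f x (u x) * τ x) volume ∧
    ∫ z, (inner ℝ (G z) (Φ z) + ‖z.1‖ ^ 2 * v z * φ z) ∂(halfMeasure N)
      = ∫ x, f x (u x) * τ x

/-- `|f(x,t)|/t → 0` as `t → 0`, uniformly in `x`. -/
def CondF1 {N : ℕ} (f : EuclideanSpace ℝ (Fin N) → ℝ → ℝ) : Prop :=
  TendstoUniformly (fun (t : ℝ) (x : EuclideanSpace ℝ (Fin N)) => |f x t| / t)
    (fun _ => 0) (𝓝[≠] 0)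

/-- `|f(x,t)|/|t|^{θ-1} → 0` as `|t| → ∞`, uniformly in `x`, for some `2 < θ < 2N/(N-1)`. -/
def CondF2 {N : ℕ} (f : EuclideanSpace ℝ (Fin N) → ℝ → ℝ) : Prop :=
  ∃ θ : ℝ, 2 < θ ∧ θ < 2 * (N : ℝ) / ((N : ℝ) - 1) ∧
    TendstoUniformly
      (fun (t : ℝ) (x : EuclideanSpace ℝ (Fin N)) => |f x t| / |t| ^ (θ - 1))
      (fun _ => 0) (comap (fun t : ℝ => |t|) atTop)

end HarmonicExtension

/-!
The trace is square integrable, so the point is that it is bounded, which is De Giorgi's theorem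
for the boundary problem.

The conditions on `f` control `f x t` uniformly in `x` only for small and for large `|t|`, while
for intermediate `t` it may be unbounded in `x`. So the equation is only tested with functions
`η(v)` for which `η` vanishes on `[-m, m]`, where `m` is at least the level `M` above which
`|f x t| ≤ |t|^(θ-1)`. If `η' = (ψ')²`, then the equation bounds the Dirichlet integral of `ψ(v)`
by `∫ |u|^θ` over `{|u| > m}` (`eLpNorm_grad_truncation_sq_le`), since the term with the weight
`|x|²` has the good sign. When `ψ` is a smooth version of the excess over a level `k > m`
(`exists_truncation`), the trace inequality with the critical exponent `q = 2N/(N-1)` bounds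
`∫ (|u| - k)₊^q` by a constant times `(∫_{|u| > m} |u|^θ)^(q/2)`. On `{|u| > m}`, the power `|u|^θ`
is at most a multiple of the `q`-th power of the excess over any lower level, because `θ < q`;
the multiple is small if the levels are high. Since `q/2 > 1`, iterating over levels between `K`
and `2K` shows that `|u| ≤ 2K` almost everywhere for some large `K` (`exists_ae_bound_of_levels`).

The trace inequality (`exists_trace_inequality`) follows from the fundamental theorem of calculus
for `|w|^q` in the normal direction, Hölder's inequality and the Sobolev inequality in the
half-space (`exists_sobolev_halfSpace`); the latter is the Gagliardo-Nirenberg-Sobolev inequality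
for the even reflection. The trace exists (`IsWeakGrad.exists_isTrace`) because smooth compactly
supported functions are dense: the extension by zero is mollified with a kernel supported below
the boundary, which does not see the jump there (`classicalGrad_mollify`).

The chain rule for truncations is obtained for limits of smooth functions (`IsSmoothLimit`).
-/

namespace HarmonicExtension

/-! ### Gradients of smooth functions -/

section Gradient

variable {N : ℕ}

theorem norm_toLp_prod_le (a : EuclideanSpace ℝ (Fin N)) (b : ℝ) :
    ‖(WithLp.toLp 2 (a, b) : Vec N)‖ ≤ ‖a‖ + ‖b‖ := by
  have h : ‖(WithLp.toLp 2 (a, b) : Vec N)‖ ^ 2 = ‖a‖ ^ 2 + ‖b‖ ^ 2 :=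
    WithLp.prod_norm_sq_eq_of_L2 _
  refine le_of_sq_le_sq ?_ (by positivity)
  nlinarith [norm_nonneg a, norm_nonneg b]

/-- The linear map that turns the Fréchet derivative of a function on `ℝ^N × ℝ` (a continuous
linear functional for the sup norm of the product) into its Euclidean gradient. -/
noncomputable def gradLinear (N : ℕ) : (Pt N →L[ℝ] ℝ) →ₗ[ℝ] Vec N where
  toFun ℓ := WithLp.toLp 2
    ((InnerProductSpace.toDual ℝ (EuclideanSpace ℝ (Fin N))).symm
      (ℓ.comp (ContinuousLinearMap.inl ℝ _ _)), ℓ (0, 1))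
  map_add' a b := by
    rw [← WithLp.toLp_add, ContinuousLinearMap.add_comp, map_add]; rfl
  map_smul' c a := by
    rw [RingHom.id_apply, ← WithLp.toLp_smul, ContinuousLinearMap.smul_comp, map_smulₛₗ]; rfl

/-- `gradLinear` as a continuous linear map. -/
noncomputable def gradOfFDeriv (N : ℕ) : (Pt N →L[ℝ] ℝ) →L[ℝ] Vec N :=
  (gradLinear N).mkContinuous 2 fun ℓ => by
    refine (norm_toLp_prod_le _ _).trans ?_
    have h1 : ‖ℓ.comp (ContinuousLinearMap.inl ℝ (EuclideanSpace ℝ (Fin N)) ℝ)‖ ≤ ‖ℓ‖ * 1 :=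
      (ℓ.opNorm_comp_le _).trans
        (mul_le_mul_of_nonneg_left (ContinuousLinearMap.norm_inl_le_one ℝ _ _) (norm_nonneg _))
    have h2 : ‖ℓ (0, 1)‖ ≤ ‖ℓ‖ := by
      simpa using ℓ.le_opNorm ((0, 1) : Pt N)
    rw [LinearIsometryEquiv.norm_map]
    linarith

theorem gradOfFDeriv_apply (ℓ : Pt N →L[ℝ] ℝ) :
    gradOfFDeriv N ℓ = WithLp.toLp 2
      ((InnerProductSpace.toDual ℝ (EuclideanSpace ℝ (Fin N))).symm
        (ℓ.comp (ContinuousLinearMap.inl ℝ _ _)), ℓ (0, 1)) := rfl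

theorem inner_gradOfFDeriv (ℓ : Pt N →L[ℝ] ℝ) (e : Vec N) :
    inner ℝ (gradOfFDeriv N ℓ) e = ℓ (e.fst, e.snd) := by
  have h : ((e.fst, e.snd) : Pt N) = (e.fst, 0) + e.snd • ((0, 1) : Pt N) := by
    ext <;> simp
  rw [h, map_add, map_smul]
  simp [gradOfFDeriv_apply, WithLp.prod_inner_apply]

theorem classicalGrad_eq {φ : Pt N → ℝ} {z : Pt N} (h : DifferentiableAt ℝ φ z) :
    classicalGrad φ z = gradOfFDeriv N (fderiv ℝ φ z) := by
  have h1 : HasFDerivAt (fun x => φ (x, z.2))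
      ((fderiv ℝ φ z).comp (ContinuousLinearMap.inl ℝ _ _)) z.1 :=
    HasFDerivAt.comp (g := φ) (f := fun x => (x, z.2)) z.1 h.hasFDerivAt
      (hasFDerivAt_prodMk_left z.1 z.2)
  have h2 : HasDerivAt (fun y => φ (z.1, y)) (fderiv ℝ φ z (0, 1)) z.2 :=
    HasFDerivAt.comp_hasDerivAt (l := φ) (f := fun y => (z.1, y)) z.2 h.hasFDerivAt
      ((hasDerivAt_const z.2 z.1).prodMk (hasDerivAt_id z.2))
  simp only [classicalGrad, gradient, h1.fderiv, h2.deriv, gradOfFDeriv_apply]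

theorem inner_classicalGrad {φ : Pt N → ℝ} {z : Pt N} (h : DifferentiableAt ℝ φ z) (e : Vec N) :
    inner ℝ (classicalGrad φ z) e = fderiv ℝ φ z (e.fst, e.snd) := by
  rw [classicalGrad_eq h, inner_gradOfFDeriv]

theorem contDiff_classicalGrad {φ : Pt N → ℝ} (h : ContDiff ℝ ∞ φ) :
    ContDiff ℝ ∞ (classicalGrad φ) := by
  have : classicalGrad φ = fun z => gradOfFDeriv N (fderiv ℝ φ z) :=
    funext fun z => classicalGrad_eq (h.differentiable (by simp) z)
  rw [this]
  exact (gradOfFDeriv N).contDiff.comp (h.fderiv_right (by simp))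

theorem hasCompactSupport_classicalGrad {φ : Pt N → ℝ} (h : ContDiff ℝ ∞ φ)
    (hc : HasCompactSupport φ) : HasCompactSupport (classicalGrad φ) := by
  have : classicalGrad φ = fun z => gradOfFDeriv N (fderiv ℝ φ z) :=
    funext fun z => classicalGrad_eq (h.differentiable (by simp) z)
  rw [this]
  exact (hc.fderiv (𝕜 := ℝ)).comp_left (g := gradOfFDeriv N) (map_zero _)

theorem classicalGrad_comp {φ : Pt N → ℝ} {η : ℝ → ℝ} {z : Pt N} (h : DifferentiableAt ℝ φ z)
    (hη : DifferentiableAt ℝ η (φ z)) :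
    classicalGrad (fun z => η (φ z)) z = deriv η (φ z) • classicalGrad φ z := by
  have h1 : HasFDerivAt (fun z => η (φ z)) (deriv η (φ z) • fderiv ℝ φ z) z :=
    hη.hasDerivAt.comp_hasFDerivAt z h.hasFDerivAt
  rw [classicalGrad_eq h1.differentiableAt, classicalGrad_eq h, h1.fderiv, map_smul]

theorem classicalGrad_mul {φ ψ : Pt N → ℝ} {z : Pt N} (h : DifferentiableAt ℝ φ z)
    (hψ : DifferentiableAt ℝ ψ z) :
    classicalGrad (fun z => φ z * ψ z) z
      = φ z • classicalGrad ψ z + ψ z • classicalGrad φ z := by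
  have h1 := h.hasFDerivAt.mul hψ.hasFDerivAt
  rw [show (fun z => φ z * ψ z) = φ * ψ from rfl,
    classicalGrad_eq h1.differentiableAt, classicalGrad_eq h, classicalGrad_eq hψ,
    h1.fderiv, map_add, map_smul, map_smul]

theorem classicalGrad_sub {φ ψ : Pt N → ℝ} {z : Pt N} (h : DifferentiableAt ℝ φ z)
    (hψ : DifferentiableAt ℝ ψ z) :
    classicalGrad (fun z => φ z - ψ z) z = classicalGrad φ z - classicalGrad ψ z := by
  have h1 := h.hasFDerivAt.sub hψ.hasFDerivAt
  rw [show (fun z => φ z - ψ z) = φ - ψ from rfl,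
    classicalGrad_eq h1.differentiableAt, classicalGrad_eq h, classicalGrad_eq hψ,
    h1.fderiv, map_sub]

theorem norm_fderiv_le_classicalGrad {φ : Pt N → ℝ} {z : Pt N} (h : DifferentiableAt ℝ φ z) :
    ‖fderiv ℝ φ z‖ ≤ 2 * ‖classicalGrad φ z‖ := by
  refine ContinuousLinearMap.opNorm_le_bound _ (by positivity) fun p => ?_
  have h1 := inner_classicalGrad h (WithLp.toLp 2 p)
  have h2 : ‖fderiv ℝ φ z p‖ ≤ ‖classicalGrad φ z‖ * ‖(WithLp.toLp 2 p : Vec N)‖ := by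
    rw [show fderiv ℝ φ z p = inner ℝ (classicalGrad φ z) (WithLp.toLp 2 p) from h1.symm]
    exact norm_inner_le_norm _ _
  refine h2.trans ?_
  have h3 : ‖(WithLp.toLp 2 p : Vec N)‖ ≤ 2 * ‖p‖ := by
    have := norm_toLp_prod_le p.1 p.2
    have a1 := norm_fst_le p
    have a2 := norm_snd_le p
    calc _ ≤ ‖p.1‖ + ‖p.2‖ := this
      _ ≤ _ := by linarith
  nlinarith [norm_nonneg (classicalGrad φ z)]

end Gradient

/-! ### Convergence in `L²` -/

section LTwo

variable {α E : Type*} {mα : MeasurableSpace α} {μ : Measure α} [NormedAddCommGroup E]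

theorem eLpNorm_two_eq (f : α → E) (μ : Measure α) :
    eLpNorm f 2 μ = (∫⁻ x, ‖f x‖ₑ ^ 2 ∂μ) ^ (1 / 2 : ℝ) := by
  rw [eLpNorm_eq_lintegral_rpow_enorm_toReal (by simp) (by simp)]
  simp

theorem eLpNorm_two_sq (f : α → E) (μ : Measure α) :
    eLpNorm f 2 μ ^ 2 = ∫⁻ x, ‖f x‖ₑ ^ 2 ∂μ := by
  rw [eLpNorm_two_eq, ← ENNReal.rpow_natCast, ← ENNReal.rpow_mul]
  simp

theorem tendsto_eLpNorm_two_zero_of_dominated {F : ℕ → α → E} {H : α → ℝ}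
    (hF : ∀ n, AEStronglyMeasurable (F n) μ) (hH : MemLp H 2 μ)
    (hb : ∀ n, ∀ᵐ x ∂μ, ‖F n x‖ ≤ H x)
    (hlim : ∀ᵐ x ∂μ, Tendsto (fun n => F n x) atTop (𝓝 0)) :
    Tendsto (fun n => eLpNorm (F n) 2 μ) atTop (𝓝 0) := by
  have key : Tendsto (fun n => ∫⁻ x, ‖F n x‖ₑ ^ 2 ∂μ) atTop (𝓝 (∫⁻ _, 0 ∂μ)) := by
    refine tendsto_lintegral_of_dominated_convergence' (fun x => ‖H x‖ₑ ^ 2) ?_ ?_ ?_ ?_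
    · exact fun n => (hF n).enorm.pow_const 2
    · intro n
      filter_upwards [hb n] with x hx
      have : ‖F n x‖ₑ ≤ ‖H x‖ₑ := by
        rw [enorm_le_iff_norm_le]
        exact hx.trans (le_abs_self _)
      gcongr
    · rw [← eLpNorm_two_sq]
      exact ENNReal.pow_ne_top hH.eLpNorm_ne_top
    · filter_upwards [hlim] with x hx
      have h1 : Tendsto (fun n => ‖F n x‖ₑ) atTop (𝓝 0) := by
        have := (continuous_enorm.tendsto (0 : E)).comp hx
        rw [enorm_zero] at this
        exact this
      simpa using ENNReal.Tendsto.pow (n := 2) h1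
  simp only [lintegral_zero] at key
  have := (ENNReal.continuous_rpow_const (y := (1 / 2 : ℝ))).tendsto 0 |>.comp key
  simp only [eLpNorm_two_eq]
  simpa [Function.comp_def] using this

theorem exists_subseq_tendsto_ae_of_eLpNorm {F : ℕ → α → E} {f : α → E}
    (hf : AEStronglyMeasurable f μ) (hF : ∀ n, AEStronglyMeasurable (F n) μ)
    (hlim : Tendsto (fun n => eLpNorm (fun x => F n x - f x) 2 μ) atTop (𝓝 0)) :
    ∃ ns : ℕ → ℕ, StrictMono ns ∧ ∀ᵐ x ∂μ, Tendsto (fun i => F (ns i) x) atTop (𝓝 (f x)) :=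
  (tendstoInMeasure_of_tendsto_eLpNorm (p := 2) (by simp) hF hf hlim).exists_seq_tendsto_ae

theorem memLp_of_tendsto_eLpNorm {F : ℕ → α → E} {f : α → E}
    (hf : AEStronglyMeasurable f μ) (hF : ∀ n, MemLp (F n) 2 μ)
    (hlim : Tendsto (fun n => eLpNorm (fun x => F n x - f x) 2 μ) atTop (𝓝 0)) :
    MemLp f 2 μ := by
  obtain ⟨n, hn⟩ := (hlim.eventually_lt_const one_pos).exists
  have h1 : MemLp (fun x => F n x - f x) 2 μ :=
    ⟨(hF n).1.sub hf, hn.trans ENNReal.one_lt_top⟩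
  have h2 := (hF n).sub h1
  refine h2.ae_eq (ae_of_all _ fun x => ?_)
  simp

variable [NormedSpace ℝ E]

theorem tendsto_integral_smul_of_tendsto_eLpNorm {F : ℕ → α → ℝ} {f : α → ℝ} {g : α → E}
    (hf : AEStronglyMeasurable f μ) (hF : ∀ n, MemLp (F n) 2 μ) (hg : MemLp g 2 μ)
    (hlim : Tendsto (fun n => eLpNorm (fun x => F n x - f x) 2 μ) atTop (𝓝 0)) :
    Tendsto (fun n => ∫ x, F n x • g x ∂μ) atTop (𝓝 (∫ x, f x • g x ∂μ)) := by
  refine tendsto_integral_of_L1' _ (hf.smul hg.1) (Eventually.of_forall fun n => ?_) ?_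
  · exact memLp_one_iff_integrable.1 (hg.smul (hF n))
  · have h0 : Tendsto (fun n => eLpNorm (fun x => F n x - f x) 2 μ * eLpNorm g 2 μ)
        atTop (𝓝 0) := by
      simpa using ENNReal.Tendsto.mul_const hlim (Or.inr hg.eLpNorm_ne_top)
    refine tendsto_of_tendsto_of_tendsto_of_le_of_le tendsto_const_nhds h0
      (fun _ => zero_le) fun n => ?_
    refine le_trans (le_of_eq ?_) (eLpNorm_smul_le_mul_eLpNorm (r := 1) hg.1 ((hF n).1.sub hf))
    congr 1
    ext x
    simp [sub_smul]

theorem tendsto_integral_smul_of_tendsto_eLpNorm' {F : ℕ → α → E} {f : α → E} {g : α → ℝ}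
    (hf : AEStronglyMeasurable f μ) (hF : ∀ n, MemLp (F n) 2 μ) (hg : MemLp g 2 μ)
    (hlim : Tendsto (fun n => eLpNorm (fun x => F n x - f x) 2 μ) atTop (𝓝 0)) :
    Tendsto (fun n => ∫ x, g x • F n x ∂μ) atTop (𝓝 (∫ x, g x • f x ∂μ)) := by
  refine tendsto_integral_of_L1' _ (hg.1.smul hf) (Eventually.of_forall fun n => ?_) ?_
  · exact memLp_one_iff_integrable.1 ((hF n).smul hg)
  · have h0 : Tendsto (fun n => eLpNorm g 2 μ * eLpNorm (fun x => F n x - f x) 2 μ)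
        atTop (𝓝 0) := by
      simpa using ENNReal.Tendsto.const_mul hlim (Or.inr hg.eLpNorm_ne_top)
    refine tendsto_of_tendsto_of_tendsto_of_le_of_le tendsto_const_nhds h0
      (fun _ => zero_le) fun n => ?_
    refine le_trans (le_of_eq ?_) (eLpNorm_smul_le_mul_eLpNorm (r := 1) ((hF n).1.sub hf) hg.1)
    congr 1
    ext x
    simp [smul_sub]

end LTwo

/-! ### Weak gradients and traces as limits of smooth functions -/

section Weak

variable {N : ℕ}

instance instIsAddHaarMeasureVolumePt : (volume : Measure (Pt N)).IsAddHaarMeasure :=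
  inferInstanceAs (Measure.IsAddHaarMeasure
    ((volume : Measure (EuclideanSpace ℝ (Fin N))).prod (volume : Measure ℝ)))

theorem measurableSet_halfSpace (N : ℕ) : MeasurableSet (halfSpace N) :=
  measurableSet_lt measurable_const measurable_snd

theorem memLp_of_contDiff {E : Type*} [NormedAddCommGroup E] [NormedSpace ℝ E]
    {w : Pt N → E} (hw : ContDiff ℝ ∞ w)
    (hc : HasCompactSupport w) : MemLp w 2 (halfMeasure N) :=
  (hw.continuous.memLp_of_hasCompactSupport hc).restrict _

theorem memLp_boundary_of_contDiff {w : Pt N → ℝ} (hw : ContDiff ℝ ∞ w)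
    (hc : HasCompactSupport w) :
    MemLp (fun x : EuclideanSpace ℝ (Fin N) => w (x, 0)) 2 volume :=
  (hw.continuous.comp (by fun_prop)).memLp_of_hasCompactSupport
    (HasCompactSupport.intro (hc.isCompact.image continuous_fst) fun x hx =>
      image_eq_zero_of_notMem_tsupport (f := w) fun hm => hx ⟨(x, 0), hm, rfl⟩)

theorem integral_halfMeasure_of_eq_zero {E : Type*} [NormedAddCommGroup E] [NormedSpace ℝ E]
    {F : Pt N → E} (h : ∀ z, z ∉ halfSpace N → F z = 0) :
    ∫ z, F z ∂(halfMeasure N) = ∫ z, F z :=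
  setIntegral_eq_integral_of_forall_compl_eq_zero h

/-- Integration by parts: a smooth function has its classical gradient as weak gradient. -/
theorem integral_smul_classicalGrad {w φ : Pt N → ℝ} (hw : ContDiff ℝ ∞ w)
    (hφ : ContDiff ℝ ∞ φ) (hc : HasCompactSupport φ) (hs : tsupport φ ⊆ halfSpace N) :
    ∫ z, w z • classicalGrad φ z ∂(halfMeasure N)
      = - ∫ z, φ z • classicalGrad w z ∂(halfMeasure N) := by
  have hdφ : Differentiable ℝ φ := hφ.differentiable (by simp)
  have hdw : Differentiable ℝ w := hw.differentiable (by simp)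
  have h0 : ∀ z, z ∉ halfSpace N → φ z = 0 := fun z hz =>
    image_eq_zero_of_notMem_tsupport fun h => hz (hs h)
  have h0' : ∀ z, z ∉ halfSpace N → classicalGrad φ z = 0 := fun z hz => by
    rw [classicalGrad_eq (hdφ z),
      image_eq_zero_of_notMem_tsupport (fun h => hz (hs (tsupport_fderiv_subset ℝ h))), map_zero]
  rw [integral_halfMeasure_of_eq_zero (fun z hz => by simp [h0' z hz]),
    integral_halfMeasure_of_eq_zero (fun z hz => by simp [h0 z hz])]
  have i1 : Integrable (fun z => w z • classicalGrad φ z) :=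
    (hw.continuous.smul (contDiff_classicalGrad hφ).continuous).integrable_of_hasCompactSupport
      (hasCompactSupport_classicalGrad hφ hc).smul_left
  have i2 : Integrable (fun z => φ z • classicalGrad w z) :=
    (hφ.continuous.smul (contDiff_classicalGrad hw).continuous).integrable_of_hasCompactSupport
      hc.smul_right
  refine ext_inner_left ℝ fun e => ?_
  rw [inner_neg_right, ← integral_inner i1, ← integral_inner i2]
  have e1 : ∀ z, inner ℝ e (w z • classicalGrad φ z)
      = w z * fderiv ℝ φ z (e.fst, e.snd) := fun z => by
    rw [inner_smul_right, real_inner_comm, inner_classicalGrad (hdφ z)]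
  have e2 : ∀ z, inner ℝ e (φ z • classicalGrad w z)
      = fderiv ℝ w z (e.fst, e.snd) * φ z := fun z => by
    rw [inner_smul_right, real_inner_comm, inner_classicalGrad (hdw z), mul_comm]
  have j1 := (integrable_congr (ae_of_all _ e1)).1 (i1.const_inner e)
  have j2 := (integrable_congr (ae_of_all _ e2)).1 (i2.const_inner e)
  simp only [e1, e2]
  refine integral_mul_fderiv_eq_neg_fderiv_mul_of_integrable j2 j1 ?_
    (fun z _ => hdw z) (fun z _ => hdφ z)
  exact (hw.continuous.mul hφ.continuous).integrable_of_hasCompactSupport hc.mul_left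

/-- The triple `(v, G, u)` is a simultaneous `L²` limit of a smooth compactly supported function,
of its gradient and of its restriction to the boundary. Such triples are exactly the
`H¹` functions with their gradients and traces, and this form is stable under composition with
smooth functions. -/
structure IsSmoothLimit (v : Pt N → ℝ) (G : Pt N → Vec N)
    (u : EuclideanSpace ℝ (Fin N) → ℝ) : Prop where
  aesm_fun : AEStronglyMeasurable v (halfMeasure N)
  aesm_grad : AEStronglyMeasurable G (halfMeasure N)
  aesm_trace : AEStronglyMeasurable u volume
  exists_seq : ∃ w : ℕ → Pt N → ℝ, (∀ n, ContDiff ℝ ∞ (w n) ∧ HasCompactSupport (w n)) ∧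
    Tendsto (fun n => eLpNorm (fun z => w n z - v z) 2 (halfMeasure N)) atTop (𝓝 0) ∧
    Tendsto (fun n => eLpNorm (fun z => classicalGrad (w n) z - G z) 2 (halfMeasure N))
      atTop (𝓝 0) ∧
    Tendsto (fun n => eLpNorm (fun x => w n (x, 0) - u x) 2 volume) atTop (𝓝 0)

theorem IsTrace.exists_isSmoothLimit {v : Pt N → ℝ} {u : EuclideanSpace ℝ (Fin N) → ℝ}
    (h : IsTrace v u) : ∃ G, IsSmoothLimit v G u := by
  obtain ⟨hu, G, hG, w, hw⟩ := h
  exact ⟨G, hG.memLp_fun.1, hG.memLp_grad.1, hu, w, hw⟩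

namespace IsSmoothLimit

variable {v : Pt N → ℝ} {G : Pt N → Vec N} {u : EuclideanSpace ℝ (Fin N) → ℝ}

theorem isWeakGrad (h : IsSmoothLimit v G u) : IsWeakGrad v G := by
  obtain ⟨hv, hG, hu, w, hw, h1, h2, h3⟩ := h
  have m1 := fun n => memLp_of_contDiff (hw n).1 (hw n).2
  have m2 := fun n => memLp_of_contDiff (contDiff_classicalGrad (hw n).1)
    (hasCompactSupport_classicalGrad (hw n).1 (hw n).2)
  refine ⟨memLp_of_tendsto_eLpNorm hv m1 h1, memLp_of_tendsto_eLpNorm hG m2 h2, ?_⟩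
  intro φ hφ hc hs
  have t1 := tendsto_integral_smul_of_tendsto_eLpNorm hv m1
    (memLp_of_contDiff (contDiff_classicalGrad hφ) (hasCompactSupport_classicalGrad hφ hc)) h1
  have t2 := (tendsto_integral_smul_of_tendsto_eLpNorm' hG m2 (memLp_of_contDiff hφ hc) h2).neg
  refine tendsto_nhds_unique t1 (t2.congr fun n => ?_)
  exact (integral_smul_classicalGrad (hw n).1 hφ hc hs).symm

theorem isTrace (h : IsSmoothLimit v G u) : IsTrace v u :=
  ⟨h.aesm_trace, G, h.isWeakGrad, h.exists_seq⟩

/-- Chain rule for weak gradients and traces. -/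
theorem comp (h : IsSmoothLimit v G u) {η : ℝ → ℝ} (hη : ContDiff ℝ ∞ η) (h0 : η 0 = 0)
    (h1 : ∀ t, |deriv η t| ≤ 1) :
    IsSmoothLimit (fun z => η (v z)) (fun z => deriv η (v z) • G z) (fun x => η (u x)) := by
  have hGm := h.isWeakGrad.memLp_grad
  obtain ⟨hv, hG, hu, w, hw, c1, c2, c3⟩ := h
  have hd : Differentiable ℝ η := hη.differentiable (by simp)
  have hdc : Continuous (deriv η) := hη.continuous_deriv (by simp)
  have hL : LipschitzWith 1 η := lipschitzWith_of_nnnorm_deriv_le hd fun t => h1 t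
  have hL' : ∀ s t, ‖η s - η t‖ ≤ ‖s - t‖ := fun s t => by
    simpa using hL.norm_sub_le s t
  have hwm : ∀ n, AEStronglyMeasurable (w n) (halfMeasure N) := fun n =>
    (hw n).1.continuous.aestronglyMeasurable
  have hgm : ∀ n, AEStronglyMeasurable (classicalGrad (w n)) (halfMeasure N) := fun n =>
    (contDiff_classicalGrad (hw n).1).continuous.aestronglyMeasurable
  obtain ⟨ns, hns, hae⟩ := exists_subseq_tendsto_ae_of_eLpNorm hv hwm c1
  have c1' := c1.comp hns.tendsto_atTop
  have c2' := c2.comp hns.tendsto_atTop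
  have c3' := c3.comp hns.tendsto_atTop
  refine ⟨hη.continuous.comp_aestronglyMeasurable hv,
    (hdc.comp_aestronglyMeasurable hv).smul hG, hη.continuous.comp_aestronglyMeasurable hu,
    fun n z => η (w (ns n) z), fun n => ⟨hη.comp (hw _).1, (hw _).2.comp_left h0⟩, ?_, ?_, ?_⟩
  · exact tendsto_of_tendsto_of_tendsto_of_le_of_le tendsto_const_nhds c1' (fun _ => zero_le)
      fun n => eLpNorm_mono fun z => hL' _ _
  · -- `η'(wₙ)∇wₙ - η'(v)G = η'(wₙ)(∇wₙ - G) + (η'(wₙ) - η'(v))G`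
    have d : Tendsto (fun n => eLpNorm (fun z => (deriv η (w (ns n) z) - deriv η (v z)) • G z) 2
        (halfMeasure N)) atTop (𝓝 0) := by
      refine tendsto_eLpNorm_two_zero_of_dominated (H := fun z => 2 * ‖G z‖) (fun n => ?_)
        (hGm.norm.const_mul 2) (fun n => ae_of_all _ fun z => ?_) ?_
      · exact ((hdc.comp_aestronglyMeasurable (hwm _)).sub
          (hdc.comp_aestronglyMeasurable hv)).smul hG
      · rw [norm_smul]
        refine mul_le_mul_of_nonneg_right ?_ (norm_nonneg _)
        refine (norm_sub_le _ _).trans ?_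
        have a := h1 (w (ns n) z)
        have b := h1 (v z)
        simp only [Real.norm_eq_abs]
        linarith
      · filter_upwards [hae] with z hz
        have := ((hdc.tendsto (v z)).comp hz).sub_const (deriv η (v z))
        rw [sub_self] at this
        simpa using this.smul_const (G z)
    have hsum := c2'.add d
    rw [add_zero] at hsum
    refine tendsto_of_tendsto_of_tendsto_of_le_of_le tendsto_const_nhds hsum (fun _ => zero_le)
      fun n => ?_
    have e : (fun z => classicalGrad (fun z => η (w (ns n) z)) z - deriv η (v z) • G z)
        = (fun z => deriv η (w (ns n) z) • (classicalGrad (w (ns n)) z - G z))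
          + fun z => (deriv η (w (ns n) z) - deriv η (v z)) • G z := by
      ext1 z
      rw [Pi.add_apply, classicalGrad_comp ((hw (ns n)).1.differentiable (by simp) z) (hd _),
        smul_sub, sub_smul]
      abel
    rw [e]
    refine (eLpNorm_add_le ?_ ?_ (by norm_num)).trans ?_
    · exact (hdc.comp_aestronglyMeasurable (hwm _)).smul ((hgm _).sub hG)
    · exact ((hdc.comp_aestronglyMeasurable (hwm _)).sub
          (hdc.comp_aestronglyMeasurable hv)).smul hG
    · refine add_le_add (eLpNorm_mono fun z => ?_) le_rfl
      rw [norm_smul]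
      exact mul_le_of_le_one_left (norm_nonneg _) (h1 _)
  · exact tendsto_of_tendsto_of_tendsto_of_le_of_le tendsto_const_nhds c3' (fun _ => zero_le)
      fun n => eLpNorm_mono fun z => hL' _ _

end IsSmoothLimit

end Weak

/-! ### Sobolev and trace inequalities in the half-space -/

section Sobolev

variable {N : ℕ}

/-- An inequality `‖f‖_p ≤ C ‖g‖_2` passes to limits, by Fatou's lemma on the left-hand side. -/
theorem eLpNorm_le_of_tendsto {α β E F : Type*} {mα : MeasurableSpace α} {mβ : MeasurableSpace β}
    [NormedAddCommGroup E] [NormedAddCommGroup F] {μ : Measure α} {ν : Measure β} {p C : ℝ≥0∞}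
    (hC : C ≠ ⊤) {f : ℕ → α → E} {f' : α → E} {g : ℕ → β → F} {g' : β → F}
    (hf : ∀ n, AEStronglyMeasurable (f n) μ) (hg : ∀ n, AEStronglyMeasurable (g n) ν)
    (hg' : AEStronglyMeasurable g' ν)
    (hfg : ∀ n, eLpNorm (f n) p μ ≤ C * eLpNorm (g n) 2 ν)
    (hlim : ∀ᵐ x ∂μ, Tendsto (fun n => f n x) atTop (𝓝 (f' x)))
    (hlim' : Tendsto (fun n => eLpNorm (fun z => g n z - g' z) 2 ν) atTop (𝓝 0)) :
    eLpNorm f' p μ ≤ C * eLpNorm g' 2 ν := by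
  refine (Lp.eLpNorm_lim_le_liminf_eLpNorm hf _ hlim).trans ?_
  have hb : ∀ n, eLpNorm (f n) p μ
      ≤ C * (eLpNorm (fun z => g n z - g' z) 2 ν + eLpNorm g' 2 ν) := fun n => by
    refine (hfg n).trans (mul_le_mul_right ?_ _)
    refine le_trans (le_of_eq ?_) (eLpNorm_add_le ((hg n).sub hg') hg' (by norm_num))
    congr 1
    ext1 z
    simp
  refine (liminf_le_liminf (Eventually.of_forall hb)).trans (le_of_eq ?_)
  refine Tendsto.liminf_eq ?_
  have := ENNReal.Tendsto.const_mul (a := C) (hlim'.add_const (eLpNorm g' 2 ν)) (Or.inr hC)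
  simpa using this

/-- Smoothed folding `(x, s) ↦ (x, √(s² + δ))` of the whole space onto the half-space. -/
noncomputable def foldPt (δ : ℝ) (z : Pt N) : Pt N := (z.1, √(z.2 ^ 2 + δ))

theorem lipschitzWith_sqrt_sq_add {δ : ℝ} (hδ : 0 ≤ δ) :
    LipschitzWith 1 fun s : ℝ => √(s ^ 2 + δ) := by
  refine LipschitzWith.of_le_add fun a b => ?_
  have h1 : |b| ≤ √(b ^ 2 + δ) := Real.abs_le_sqrt (by linarith)
  have h2 : √(b ^ 2 + δ) ^ 2 = b ^ 2 + δ := Real.sq_sqrt (by positivity)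
  rw [Real.dist_eq]
  refine Real.sqrt_le_iff.2 ⟨by positivity, ?_⟩
  have h3 : b * (a - b) ≤ |a - b| * √(b ^ 2 + δ) := by
    calc b * (a - b) ≤ |b * (a - b)| := le_abs_self _
      _ = |a - b| * |b| := by rw [abs_mul, mul_comm]
      _ ≤ _ := by gcongr
  have h4 : |a - b| ^ 2 = (a - b) ^ 2 := sq_abs _
  nlinarith

theorem lipschitzWith_foldPt {δ : ℝ} (hδ : 0 ≤ δ) : LipschitzWith 1 (foldPt δ : Pt N → Pt N) := by
  have h := (LipschitzWith.prod_fst (α := EuclideanSpace ℝ (Fin N)) (β := ℝ)).prodMk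
    ((lipschitzWith_sqrt_sq_add hδ).comp LipschitzWith.prod_snd)
  rw [one_mul, max_self] at h
  exact h

theorem contDiff_foldPt {δ : ℝ} (hδ : 0 < δ) : ContDiff ℝ ∞ (foldPt δ : Pt N → Pt N) := by
  refine contDiff_fst.prodMk (ContDiff.sqrt ((contDiff_snd.pow 2).add contDiff_const) fun z => ?_)
  positivity

theorem norm_le_norm_foldPt {δ : ℝ} (hδ : 0 ≤ δ) (z : Pt N) : ‖z‖ ≤ ‖foldPt δ z‖ := by
  rw [Prod.norm_def, Prod.norm_def]
  refine max_le_max le_rfl ?_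
  simp only [foldPt, Real.norm_eq_abs]
  rw [abs_of_nonneg (Real.sqrt_nonneg _)]
  exact Real.abs_le_sqrt (by linarith)

theorem tendsto_foldPt (z : Pt N) :
    Tendsto (fun n : ℕ => foldPt (1 / ((n : ℝ) + 1)) z) atTop (𝓝 (z.1, |z.2|)) := by
  refine tendsto_const_nhds.prodMk_nhds ?_
  have h := (tendsto_one_div_add_atTop_nhds_zero_nat (𝕜 := ℝ)).const_add (z.2 ^ 2)
  rw [add_zero] at h
  rw [← Real.sqrt_sq_eq_abs]
  exact (Real.continuous_sqrt.tendsto _).comp h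

theorem halfMeasure_eq_prod (N : ℕ) :
    halfMeasure N = (volume : Measure (EuclideanSpace ℝ (Fin N))).prod
      ((volume : Measure ℝ).restrict (Set.Ioi 0)) := by
  have h : halfSpace N = Set.univ ×ˢ Set.Ioi (0 : ℝ) := by
    ext z; simp [halfSpace]
  rw [halfMeasure, h, Measure.volume_eq_prod, ← Measure.prod_restrict, Measure.restrict_univ]

theorem lintegral_comp_abs_eq {g : ℝ → ℝ≥0∞} :
    ∫⁻ s, g |s| = 2 * ∫⁻ s in Set.Ioi 0, g s := by
  have e1 : ∫⁻ s in Set.Ioi 0, g |s| = ∫⁻ s in Set.Ioi 0, g s :=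
    setLIntegral_congr_fun measurableSet_Ioi fun s hs => by
      rw [abs_of_pos hs]
  have e2 : ∫⁻ s in Set.Iic 0, g |s| = ∫⁻ s in Set.Ioi 0, g |s| := by
    rw [← setLIntegral_congr (μ := volume) (f := fun s => g |s|) Iio_ae_eq_Iic]
    have h := (Measure.measurePreserving_neg (volume : Measure ℝ)).setLIntegral_comp_preimage_emb
      (MeasurableEquiv.neg ℝ).measurableEmbedding (fun s => g |s|) (Set.Ioi 0)
    simpa using h
  rw [← lintegral_add_compl _ (measurableSet_Ioi (a := (0 : ℝ))), Set.compl_Ioi, e2, e1, two_mul]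

theorem lintegral_fold_eq {g : Pt N → ℝ≥0∞} (hg : Measurable g) :
    ∫⁻ z : Pt N, g (z.1, |z.2|) = 2 * ∫⁻ z, g z ∂(halfMeasure N) := by
  have hm : Measurable fun z : Pt N => g (z.1, |z.2|) :=
    hg.comp (measurable_fst.prodMk (measurable_norm.comp measurable_snd))
  rw [halfMeasure_eq_prod, lintegral_prod _ hg.aemeasurable, Measure.volume_eq_prod,
    lintegral_prod _ hm.aemeasurable, ← lintegral_const_mul]
  · exact lintegral_congr fun x => lintegral_comp_abs_eq (g := fun s => g (x, s))
  · exact hg.lintegral_prod_right'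

/-- Sobolev inequality in the half-space, for restrictions of smooth compactly supported functions
on the whole space. It follows from the Gagliardo-Nirenberg-Sobolev inequality on the whole space
for the even reflection, which is a limit of the smooth functions `w ∘ foldPt δ`. -/
theorem exists_sobolev_halfSpace (hN : 2 ≤ N) : ∃ C : ℝ≥0∞, C ≠ ⊤ ∧
    ∀ w : Pt N → ℝ, ContDiff ℝ ∞ w → HasCompactSupport w →
      eLpNorm w (ENNReal.ofReal (2 * ((N : ℝ) + 1) / ((N : ℝ) - 1))) (halfMeasure N)
        ≤ C * eLpNorm (classicalGrad w) 2 (halfMeasure N) := by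
  have hN' : (2 : ℝ) ≤ N := by exact_mod_cast hN
  set p : ℝ := 2 * ((N : ℝ) + 1) / ((N : ℝ) - 1) with hp
  have hp0 : 0 < p := by rw [hp]; apply div_pos <;> linarith
  set S : NNReal := SNormLESNormFDerivOfEqConst ℝ (volume : Measure (Pt N)) 2 with hS
  refine ⟨S * (2 ^ (1 / 2 : ℝ) * 2), by finiteness, fun w hw hc => ?_⟩
  have hd : Differentiable ℝ w := hw.differentiable (by simp)
  obtain ⟨R, hR⟩ : ∃ R : ℝ, ∀ z : Pt N, R < ‖z‖ → z ∉ tsupport w := by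
    obtain ⟨R, hR⟩ := hc.isCompact.isBounded.subset_closedBall (0 : Pt N)
    refine ⟨R, fun z hz h => ?_⟩
    have := hR h
    rw [mem_closedBall_zero_iff] at this
    linarith
  obtain ⟨M, hM⟩ : ∃ M : ℝ, ∀ z, ‖fderiv ℝ w z‖ ≤ M :=
    (hw.continuous_fderiv (by simp)).bounded_above_of_compact_support (hc.fderiv (𝕜 := ℝ))
  have hM0 : 0 ≤ M := (norm_nonneg _).trans (hM 0)
  have hfc : Continuous (fderiv ℝ w) := hw.continuous_fderiv (by simp)
  let δ : ℕ → ℝ := fun n => 1 / ((n : ℝ) + 1)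
  have hδ : ∀ n, 0 < δ n := fun n => by simp only [δ]; positivity
  -- Gagliardo-Nirenberg-Sobolev for the smoothed reflections
  have hgns : ∀ n, eLpNorm (fun z => w (foldPt (δ n) z)) (ENNReal.ofReal p) volume
      ≤ S * eLpNorm (fun z => fderiv ℝ w (foldPt (δ n) z)) 2 volume := by
    intro n
    have hs : ContDiff ℝ ∞ fun z => w (foldPt (δ n) z) := hw.comp (contDiff_foldPt (hδ n))
    have hcs : HasCompactSupport fun z => w (foldPt (δ n) z) := by
      refine HasCompactSupport.intro (isCompact_closedBall 0 R) fun z hz => ?_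
      refine image_eq_zero_of_notMem_tsupport (hR _ ?_)
      refine lt_of_lt_of_le ?_ (norm_le_norm_foldPt (hδ n).le z)
      simpa using hz
    have hfr : Module.finrank ℝ (Pt N) = N + 1 := by simp
    have h := eLpNorm_le_eLpNorm_fderiv_of_eq (F := ℝ) (volume : Measure (Pt N))
      (hs.of_le (by simp)) hcs (p := 2) (p' := Real.toNNReal p) (by norm_num)
      (by rw [hfr]; omega) (by
        rw [hfr, Real.coe_toNNReal _ hp0.le, hp]
        have : (N : ℝ) - 1 ≠ 0 := by linarith
        have : (N : ℝ) + 1 ≠ 0 := by linarith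
        push_cast
        field_simp
        ring)
    refine h.trans ?_
    refine mul_le_mul_right (eLpNorm_mono fun z => ?_) _
    rw [show (fun z => w (foldPt (δ n) z)) = w ∘ foldPt (δ n) from rfl,
      fderiv_comp z (hd _) ((contDiff_foldPt (hδ n)).differentiable (by simp) z)]
    refine (ContinuousLinearMap.opNorm_comp_le _ _).trans
      (mul_le_of_le_one_right (norm_nonneg _) ?_)
    exact norm_fderiv_le_of_lipschitz ℝ (lipschitzWith_foldPt (hδ n).le)
  have hfold : ∀ n, Continuous (foldPt (δ n) : Pt N → Pt N) :=
    fun n => (lipschitzWith_foldPt (hδ n).le).continuous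
  have habs : Continuous fun z : Pt N => ((z.1, |z.2|) : Pt N) := by fun_prop
  -- the gradients of the smoothed reflections converge in `L²`
  have hconv : Tendsto (fun n => eLpNorm
      (fun z : Pt N => fderiv ℝ w (foldPt (δ n) z) - fderiv ℝ w (z.1, |z.2|)) 2 volume)
      atTop (𝓝 0) := by
    refine tendsto_eLpNorm_two_zero_of_dominated
      (H := (Metric.closedBall (0 : Pt N) R).indicator fun _ => 2 * M) (fun n => ?_) ?_
      (fun n => ae_of_all _ fun z => ?_) (ae_of_all _ fun z => ?_)
    · exact ((hfc.comp (hfold n)).sub (hfc.comp habs)).aestronglyMeasurable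
    · exact memLp_indicator_const 2 Metric.isClosed_closedBall.measurableSet _
        (Or.inr (isCompact_closedBall _ _).measure_lt_top.ne)
    · by_cases hz : z ∈ Metric.closedBall (0 : Pt N) R
      · rw [Set.indicator_of_mem hz]
        refine (norm_sub_le _ _).trans ?_
        linarith [hM (foldPt (δ n) z), hM (z.1, |z.2|)]
      · have hz' : R < ‖z‖ := by simpa using hz
        have z1 : ∀ y : Pt N, R < ‖y‖ → fderiv ℝ w y = 0 := fun y hy =>
          image_eq_zero_of_notMem_tsupport fun h => hR y hy (tsupport_fderiv_subset ℝ h)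
        rw [z1 _ (hz'.trans_le (norm_le_norm_foldPt (hδ n).le z)), z1 (z.1, |z.2|),
          Set.indicator_of_notMem hz]
        · simp
        · simpa [Prod.norm_def] using hz'
    · have := ((hfc.tendsto _).comp (tendsto_foldPt z)).sub_const (fderiv ℝ w (z.1, |z.2|))
      rwa [sub_self] at this
  have hlim : eLpNorm (fun z : Pt N => w (z.1, |z.2|)) (ENNReal.ofReal p) volume
      ≤ S * eLpNorm (fun z : Pt N => fderiv ℝ w (z.1, |z.2|)) 2 volume := by
    exact eLpNorm_le_of_tendsto (by simp)
      (fun n => (hw.continuous.comp (hfold n)).aestronglyMeasurable)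
      (fun n => (hfc.comp (hfold n)).aestronglyMeasurable)
      (hfc.comp habs).aestronglyMeasurable hgns
      (ae_of_all _ fun z => (hw.continuous.tendsto _).comp (tendsto_foldPt z)) hconv
  have hleft : eLpNorm w (ENNReal.ofReal p) (halfMeasure N)
      ≤ eLpNorm (fun z : Pt N => w (z.1, |z.2|)) (ENNReal.ofReal p) volume := by
    refine le_trans (le_of_eq (eLpNorm_congr_ae ?_))
      (eLpNorm_mono_measure _ Measure.restrict_le_self)
    filter_upwards [ae_restrict_mem (measurableSet_halfSpace N)] with z hz
    have : 0 < z.2 := hz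
    rw [abs_of_pos this]
  have hright : eLpNorm (fun z : Pt N => fderiv ℝ w (z.1, |z.2|)) 2 volume
      ≤ 2 ^ (1 / 2 : ℝ) * (2 * eLpNorm (classicalGrad w) 2 (halfMeasure N)) := by
    have e : eLpNorm (fun z : Pt N => fderiv ℝ w (z.1, |z.2|)) 2 volume
        = 2 ^ (1 / 2 : ℝ) * eLpNorm (fderiv ℝ w) 2 (halfMeasure N) := by
      rw [eLpNorm_two_eq, eLpNorm_two_eq, ← ENNReal.mul_rpow_of_nonneg _ _ (by norm_num),
        ← lintegral_fold_eq (g := fun z => ‖fderiv ℝ w z‖ₑ ^ 2)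
          ((hfc.enorm.measurable).pow_const 2)]
    rw [e]
    refine mul_le_mul_right ?_ _
    refine (eLpNorm_le_mul_eLpNorm_of_ae_le_mul (c := 2)
      (ae_of_all _ fun z => norm_fderiv_le_classicalGrad (hd z)) 2).trans (le_of_eq ?_)
    simp
  calc _ ≤ _ := hleft.trans hlim
    _ ≤ S * (2 ^ (1 / 2 : ℝ) * (2 * eLpNorm (classicalGrad w) 2 (halfMeasure N))) :=
        mul_le_mul_right hright _
    _ = _ := by ring

/-- The fundamental theorem of calculus in the direction normal to the boundary. -/
theorem lintegral_trace_rpow_le {w : Pt N → ℝ} (hw : ContDiff ℝ ∞ w) (hc : HasCompactSupport w)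
    {r : ℝ} (hr : 1 < r) :
    ∫⁻ x, ‖w (x, 0)‖ₑ ^ r
      ≤ ENNReal.ofReal r * ∫⁻ z, ‖w z‖ₑ ^ (r - 1) * ‖classicalGrad w z‖ₑ ∂(halfMeasure N) := by
  have hcg : Continuous (classicalGrad w) := (contDiff_classicalGrad hw).continuous
  have hm : Measurable fun z => ‖w z‖ₑ ^ (r - 1) * ‖classicalGrad w z‖ₑ :=
    (hw.continuous.enorm.measurable.pow_const _).mul hcg.enorm.measurable
  rw [halfMeasure_eq_prod, lintegral_prod _ hm.aemeasurable, ← lintegral_const_mul]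
  swap
  · exact hm.lintegral_prod_right'
  refine lintegral_mono fun x => ?_
  let h : ℝ → ℝ := fun y => w (x, y)
  have hh : ContDiff ℝ ∞ h := hw.comp (contDiff_const.prodMk contDiff_id)
  have hhc : HasCompactSupport h :=
    HasCompactSupport.intro (hc.isCompact.image continuous_snd) fun y hy =>
      image_eq_zero_of_notMem_tsupport (f := w) fun hm => hy ⟨(x, y), hm, rfl⟩
  let k : ℝ → ℝ := fun y => ‖h y‖ ^ r
  have hk : ContDiff ℝ 1 k := (contDiff_norm_rpow hr).comp (hh.of_le (by simp))
  have hkc : HasCompactSupport k := hhc.comp_left (g := fun t : ℝ => ‖t‖ ^ r)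
    (by simp [Real.zero_rpow (by linarith : r ≠ 0)])
  have e0 : ‖w (x, 0)‖ₑ ^ r = ‖k 0‖ₑ := by
    change _ = ‖‖w (x, 0)‖ ^ r‖ₑ
    rw [Real.enorm_eq_ofReal (r := ‖w (x, 0)‖ ^ r) (by positivity),
      ← ENNReal.ofReal_rpow_of_nonneg (norm_nonneg _)
      (by linarith), ofReal_norm]
  have e1 : ‖k 0‖ₑ ≤ ∫⁻ y in Set.Ioi 0, ‖deriv k y‖ₑ := by
    have := hkc.integral_Ioi_deriv_eq hk 0
    rw [← enorm_neg, ← this]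
    exact enorm_integral_le_lintegral_enorm _
  rw [e0]
  refine e1.trans ?_
  rw [← lintegral_const_mul]
  swap
  · exact hm.comp (measurable_const.prodMk measurable_id)
  refine lintegral_mono fun y => ?_
  have hdk : deriv k y = r * ‖h y‖ ^ (r - 2) * h y * deriv h y :=
    ((hasDerivAt_norm_rpow (h y) hr).comp y (hh.differentiable (by simp) y).hasDerivAt).deriv
  have hle : ‖deriv h y‖ ≤ ‖classicalGrad w (x, y)‖ :=
    WithLp.norm_snd_le _ (classicalGrad w (x, y))
  have hpow : ‖h y‖ ^ (r - 2) * ‖h y‖ = ‖h y‖ ^ (r - 1) := by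
    rcases eq_or_ne (‖h y‖) 0 with h0 | h0
    · rw [h0, mul_zero, Real.zero_rpow (by linarith)]
    · rw [← Real.rpow_add_one h0]; congr 1; ring
  have hn : ‖deriv k y‖ ≤ r * (‖h y‖ ^ (r - 1) * ‖classicalGrad w (x, y)‖) := by
    rw [hdk, norm_mul, norm_mul, norm_mul, Real.norm_of_nonneg (by linarith : (0 : ℝ) ≤ r),
      Real.norm_of_nonneg (by positivity : 0 ≤ ‖h y‖ ^ (r - 2)), mul_assoc r, hpow, mul_assoc]
    gcongr
  calc ‖deriv k y‖ₑ = ENNReal.ofReal ‖deriv k y‖ := (ofReal_norm _).symm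
    _ ≤ ENNReal.ofReal (r * (‖h y‖ ^ (r - 1) * ‖classicalGrad w (x, y)‖)) :=
        ENNReal.ofReal_le_ofReal hn
    _ = _ := by
        rw [ENNReal.ofReal_mul (by linarith), ENNReal.ofReal_mul (by positivity),
          ← ENNReal.ofReal_rpow_of_nonneg (norm_nonneg _) (by linarith), ofReal_norm,
          ofReal_norm]

theorem lintegral_trace_rpow_le_mul {w : Pt N → ℝ} (hw : ContDiff ℝ ∞ w)
    (hc : HasCompactSupport w) {r : ℝ} (hr : 1 < r) :
    ∫⁻ x, ‖w (x, 0)‖ₑ ^ r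
      ≤ ENNReal.ofReal r * ((∫⁻ z, ‖w z‖ₑ ^ (2 * (r - 1)) ∂(halfMeasure N)) ^ (1 / 2 : ℝ)
        * eLpNorm (classicalGrad w) 2 (halfMeasure N)) := by
  refine (lintegral_trace_rpow_le hw hc hr).trans (mul_le_mul_right ?_ _)
  have h := ENNReal.lintegral_mul_le_Lp_mul_Lq (halfMeasure N) Real.HolderConjugate.two_two
    (f := fun z => ‖w z‖ₑ ^ (r - 1)) (g := fun z => ‖classicalGrad w z‖ₑ)
    (hw.continuous.enorm.measurable.pow_const _).aemeasurable
    (contDiff_classicalGrad hw).continuous.enorm.measurable.aemeasurable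
  refine h.trans (le_of_eq ?_)
  rw [eLpNorm_two_eq]
  congr 2
  · refine lintegral_congr fun z => ?_
    rw [← ENNReal.rpow_mul, mul_comm]
  · simp

theorem eLpNorm_trace_two_sq_le {w : Pt N → ℝ} (hw : ContDiff ℝ ∞ w)
    (hc : HasCompactSupport w) :
    eLpNorm (fun x => w (x, 0)) 2 volume ^ 2
      ≤ 2 * (eLpNorm w 2 (halfMeasure N) * eLpNorm (classicalGrad w) 2 (halfMeasure N)) := by
  have h := lintegral_trace_rpow_le_mul hw hc (r := 2) (by norm_num)
  rw [eLpNorm_two_sq, eLpNorm_two_eq w]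
  norm_num at h ⊢
  exact h

/-- The critical trace inequality, with exponent `2N/(N-1)`. -/
theorem exists_trace_inequality (hN : 2 ≤ N) : ∃ C : ℝ≥0∞, C ≠ ⊤ ∧
    ∀ w : Pt N → ℝ, ContDiff ℝ ∞ w → HasCompactSupport w →
      eLpNorm (fun x => w (x, 0)) (ENNReal.ofReal (2 * (N : ℝ) / ((N : ℝ) - 1))) volume
        ≤ C * eLpNorm (classicalGrad w) 2 (halfMeasure N) := by
  have hN' : (2 : ℝ) ≤ N := by exact_mod_cast hN
  obtain ⟨S, hS, hsob⟩ := exists_sobolev_halfSpace hN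
  set p : ℝ := 2 * ((N : ℝ) + 1) / ((N : ℝ) - 1) with hp
  set q : ℝ := 2 * (N : ℝ) / ((N : ℝ) - 1) with hq
  have hN1 : (0 : ℝ) < (N : ℝ) - 1 := by linarith
  have hpq : 2 * (q - 1) = p := by rw [hp, hq]; field_simp; ring
  have hq2 : 2 < q := by rw [hq, lt_div_iff₀ hN1]; linarith
  have hp0 : 0 < p := by linarith
  refine ⟨(ENNReal.ofReal q * S ^ (q - 1)) ^ (1 / q), ?_, fun w hw hc => ?_⟩
  · have : 0 ≤ q - 1 := by linarith
    have : 0 ≤ 1 / q := by positivity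
    finiteness
  have h := lintegral_trace_rpow_le_mul hw hc (r := q) (by linarith)
  have hs := hsob w hw hc
  rw [eLpNorm_eq_lintegral_rpow_enorm_toReal (by simpa using hp0) (by simp),
    ENNReal.toReal_ofReal hp0.le] at hs
  rw [hpq] at h
  set A := ∫⁻ z, ‖w z‖ₑ ^ p ∂(halfMeasure N)
  set D := eLpNorm (classicalGrad w) 2 (halfMeasure N)
  have hA : A ^ (1 / 2 : ℝ) ≤ S ^ (q - 1) * D ^ (q - 1) := by
    rw [← ENNReal.mul_rpow_of_nonneg _ _ (by linarith)]
    calc A ^ (1 / 2 : ℝ) = (A ^ (1 / p)) ^ (q - 1) := by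
          rw [← ENNReal.rpow_mul]; congr 1
          rw [← hpq]
          have : q - 1 ≠ 0 := by linarith
          field_simp
      _ ≤ _ := ENNReal.rpow_le_rpow hs (by linarith)
  rw [eLpNorm_eq_lintegral_rpow_enorm_toReal (by simpa using (by linarith : 0 < q)) (by simp),
    ENNReal.toReal_ofReal (by linarith)]
  have hD : D ^ (q - 1) * D = D ^ q := by
    conv_lhs => rw [← ENNReal.rpow_one D, ← ENNReal.rpow_mul]
    rw [one_mul, ← ENNReal.rpow_add_of_nonneg _ _ (by linarith) (by norm_num)]
    congr 1; ring
  calc (∫⁻ x, ‖w (x, 0)‖ₑ ^ q) ^ (1 / q)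
      ≤ (ENNReal.ofReal q * (S ^ (q - 1) * D ^ (q - 1) * D)) ^ (1 / q) := by
        refine ENNReal.rpow_le_rpow (h.trans ?_) (by positivity)
        gcongr
    _ = (ENNReal.ofReal q * S ^ (q - 1) * D ^ q) ^ (1 / q) := by
        rw [← hD]; congr 1; ring
    _ = _ := by
        rw [ENNReal.mul_rpow_of_nonneg _ _ (by positivity), ← ENNReal.rpow_mul D,
          mul_one_div_cancel (by linarith), ENNReal.rpow_one]

/-- The critical trace inequality for `H¹` functions. -/
theorem exists_trace_inequality_of_isSmoothLimit (hN : 2 ≤ N) : ∃ C : ℝ≥0∞, C ≠ ⊤ ∧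
    ∀ (v : Pt N → ℝ) (G : Pt N → Vec N) (u : EuclideanSpace ℝ (Fin N) → ℝ),
      IsSmoothLimit v G u →
      eLpNorm u (ENNReal.ofReal (2 * (N : ℝ) / ((N : ℝ) - 1))) volume
        ≤ C * eLpNorm G 2 (halfMeasure N) := by
  obtain ⟨C, hC, htr⟩ := exists_trace_inequality hN
  refine ⟨C, hC, fun v G u ⟨hv, hG, hu, w, hw, c1, c2, c3⟩ => ?_⟩
  have hwm : ∀ n, AEStronglyMeasurable (fun x => w n (x, 0)) volume := fun n =>
    ((hw n).1.continuous.comp (by fun_prop)).aestronglyMeasurable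
  obtain ⟨ns, hns, hae⟩ := exists_subseq_tendsto_ae_of_eLpNorm hu hwm c3
  exact eLpNorm_le_of_tendsto hC (fun n => hwm (ns n))
    (fun n => (contDiff_classicalGrad (hw (ns n)).1).continuous.aestronglyMeasurable) hG
    (fun n => htr _ (hw _).1 (hw _).2) hae (c2.comp hns.tendsto_atTop)

end Sobolev

/-! ### Approximation by mollification -/

section Mollify

variable {N : ℕ} {E : Type*} [NormedAddCommGroup E]

/-- Continuity of translations in `L²`. -/
theorem exists_translation_close {g : Pt N → E} (hg : MemLp g 2 volume) {κ : ℝ≥0∞} (hκ : κ ≠ 0) :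
    ∃ δ > 0, ∀ h : Pt N, ‖h‖ < δ → eLpNorm (fun z => g (z - h) - g z) 2 volume ≤ κ := by
  let F := hg.toLp g
  let τ : C(Pt N, C(Pt N, Pt N)) :=
    (ContinuousMap.mk (fun p : Pt N × Pt N => p.2 - p.1) (by fun_prop)).curry
  have hτ : ∀ h, MeasurePreserving (τ h) (volume : Measure (Pt N)) volume := fun h =>
    measurePreserving_sub_right volume h
  have hc : Continuous fun h => Lp.compMeasurePreserving (τ h) (hτ h) F :=
    continuous_const.compMeasurePreservingLp τ.continuous hτ (by simp)
  have hF : ∀ h, Lp.compMeasurePreserving (τ h) (hτ h) F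
      = (hg.comp_measurePreserving (hτ h)).toLp (g ∘ τ h) := fun h =>
    Lp.toLp_compMeasurePreserving hg (hτ h)
  have h0 := hc.tendsto 0
  have hz : Lp.compMeasurePreserving (τ 0) (hτ 0) F = F := by
    rw [hF]
    refine MemLp.toLp_congr _ _ (ae_of_all _ fun z => ?_)
    simp [τ]
  simp only [hz] at h0
  have hev : ∀ᶠ h in 𝓝 (0 : Pt N), edist (Lp.compMeasurePreserving (τ h) (hτ h) F) F < κ :=
    (EMetric.tendsto_nhds.1 h0) κ (pos_iff_ne_zero.2 hκ)
  obtain ⟨δ, hδ, hball⟩ := Metric.eventually_nhds_iff.1 hev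
  refine ⟨δ, hδ, fun h hh => ?_⟩
  have := hball (y := h) (by simpa using hh)
  rw [hF, Lp.edist_toLp_toLp] at this
  exact this.le

variable [NormedSpace ℝ E]

/-- The convolution `ρ * g`. -/
noncomputable def mollify (ρ : Pt N → ℝ) (g : Pt N → E) (z : Pt N) : E :=
  ∫ t, ρ (z - t) • g t

theorem mollify_eq (ρ : Pt N → ℝ) (g : Pt N → E) (z : Pt N) :
    mollify ρ g z = ∫ h, ρ h • g (z - h) := by
  rw [mollify, ← integral_sub_left_eq_self _ _ z]
  simp

theorem sq_lintegral_mul_le {α : Type*} {mα : MeasurableSpace α} {μ : Measure α}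
    {a F : α → ℝ≥0∞} (ha : AEMeasurable a μ) (hF : AEMeasurable F μ) :
    (∫⁻ x, a x * F x ∂μ) ^ 2 ≤ (∫⁻ x, a x ∂μ) * ∫⁻ x, a x * F x ^ 2 ∂μ := by
  have h := ENNReal.lintegral_mul_le_Lp_mul_Lq μ Real.HolderConjugate.two_two
    (f := fun x => a x ^ (1 / 2 : ℝ)) (g := fun x => a x ^ (1 / 2 : ℝ) * F x)
    (ha.pow_const _) ((ha.pow_const _).mul hF)
  have hsq : ∀ b : ℝ≥0∞, b ^ (1 / 2 : ℝ) * b ^ (1 / 2 : ℝ) = b := fun b => by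
    rw [← ENNReal.rpow_add_of_nonneg _ _ (by norm_num) (by norm_num)]
    norm_num
  have e1 : ∀ x, ((fun x => a x ^ (1 / 2 : ℝ)) * fun x => a x ^ (1 / 2 : ℝ) * F x) x
      = a x * F x := fun x => by
    rw [Pi.mul_apply, ← mul_assoc, hsq]
  have e2 : ∀ x, (a x ^ (1 / 2 : ℝ)) ^ (2 : ℝ) = a x := fun x => by
    rw [← ENNReal.rpow_mul]; norm_num
  have e3 : ∀ x, (a x ^ (1 / 2 : ℝ) * F x) ^ (2 : ℝ) = a x * F x ^ 2 := fun x => by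
    rw [ENNReal.mul_rpow_of_nonneg _ _ (by norm_num), e2]; norm_num
  simp only [e1, e2, e3] at h
  calc _ ≤ ((∫⁻ x, a x ∂μ) ^ (1 / 2 : ℝ) * (∫⁻ x, a x * F x ^ 2 ∂μ) ^ (1 / 2 : ℝ)) ^ 2 := by
        gcongr
    _ = _ := by rw [mul_pow, pow_two, pow_two, hsq, hsq]

/-- Jensen's inequality: the `L²` distance of a mollification from the function is at most
the largest `L²` distance of its translates by points of the support of the mollifier. -/
theorem eLpNorm_mollify_sub_le [CompleteSpace E] {ρ : Pt N → ℝ} (hρ : Continuous ρ)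
    (hρc : HasCompactSupport ρ) (hρ0 : ∀ h, 0 ≤ ρ h) (hρ1 : ∫ h, ρ h = 1)
    {g : Pt N → E} (hgm : StronglyMeasurable g)
    (hg : MemLp g 2 volume) {κ : ℝ≥0∞}
    (hκ : ∀ h, ρ h ≠ 0 → eLpNorm (fun z => g (z - h) - g z) 2 volume ≤ κ) :
    eLpNorm (fun z => mollify ρ g z - g z) 2 volume ≤ κ := by
  have hρi : Integrable ρ := hρ.integrable_of_hasCompactSupport hρc
  have hρl : ∫⁻ h, ‖ρ h‖ₑ = 1 := by
    have : ∀ h, ‖ρ h‖ₑ = ENNReal.ofReal (ρ h) := fun h => Real.enorm_eq_ofReal (hρ0 h)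
    simp only [this]
    rw [← ofReal_integral_eq_lintegral_ofReal hρi (ae_of_all _ hρ0), hρ1, ENNReal.ofReal_one]
  have hρm : Measurable fun h => ‖ρ h‖ₑ := hρ.enorm.measurable
  have hdiff : StronglyMeasurable fun p : Pt N × Pt N => g (p.1 - p.2) - g p.1 :=
    (hgm.comp_measurable (measurable_fst.sub measurable_snd)).sub
      (hgm.comp_measurable measurable_fst)
  have hpt : ∀ z, ‖mollify ρ g z - g z‖ₑ ^ 2 ≤ ∫⁻ h, ‖ρ h‖ₑ * ‖g (z - h) - g z‖ₑ ^ 2 := by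
    intro z
    have hgz : MemLp (fun h => g (z - h)) 2 volume :=
      hg.comp_measurePreserving (Measure.measurePreserving_sub_left volume z)
    have i1 : Integrable fun h => ρ h • g (z - h) :=
      memLp_one_iff_integrable.1 (hgz.smul (hρ.memLp_of_hasCompactSupport (p := 2) hρc))
    have e : mollify ρ g z - g z = ∫ h, ρ h • (g (z - h) - g z) := by
      simp only [smul_sub]
      rw [integral_sub i1 (hρi.smul_const _), ← mollify_eq, integral_smul_const, hρ1, one_smul]
    have e2 : ‖mollify ρ g z - g z‖ₑ ≤ ∫⁻ h, ‖ρ h‖ₑ * ‖g (z - h) - g z‖ₑ := by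
      rw [e]
      refine (enorm_integral_le_lintegral_enorm _).trans (le_of_eq ?_)
      simp only [enorm_smul]
    have hFm : Measurable fun h => ‖g (z - h) - g z‖ₑ :=
      (hdiff.comp_measurable (measurable_const.prodMk measurable_id)).enorm
    calc _ ≤ (∫⁻ h, ‖ρ h‖ₑ * ‖g (z - h) - g z‖ₑ) ^ 2 := by gcongr
      _ ≤ _ := sq_lintegral_mul_le hρm.aemeasurable hFm.aemeasurable
      _ = _ := by rw [hρl, one_mul]
  have hmeas : Measurable fun p : Pt N × Pt N => ‖ρ p.2‖ₑ * ‖g (p.1 - p.2) - g p.1‖ₑ ^ 2 :=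
    (hρm.comp measurable_snd).mul (hdiff.enorm.pow_const 2)
  have key : eLpNorm (fun z => mollify ρ g z - g z) 2 volume ^ 2 ≤ κ ^ 2 := by
    rw [eLpNorm_two_sq]
    calc _ ≤ ∫⁻ z, ∫⁻ h, ‖ρ h‖ₑ * ‖g (z - h) - g z‖ₑ ^ 2 := lintegral_mono hpt
      _ = ∫⁻ h, ∫⁻ z, ‖ρ h‖ₑ * ‖g (z - h) - g z‖ₑ ^ 2 :=
          lintegral_lintegral_swap hmeas.aemeasurable
      _ ≤ ∫⁻ h, ‖ρ h‖ₑ * κ ^ 2 := by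
          refine lintegral_mono fun h => ?_
          have hm2 : Measurable fun z => ‖g (z - h) - g z‖ₑ ^ 2 :=
            (hdiff.comp_measurable (measurable_id.prodMk measurable_const)).enorm.pow_const 2
          rw [lintegral_const_mul _ hm2]
          rcases eq_or_ne (ρ h) 0 with h0 | h0
          · simp [h0]
          · rw [← eLpNorm_two_sq]
            have := hκ h h0
            gcongr
      _ = κ ^ 2 := by rw [lintegral_mul_const _ hρm, hρl, one_mul]
  exact (ENNReal.pow_le_pow_left_iff two_ne_zero).1 key

end Mollify

section Density

variable {N : ℕ}

theorem contDiff_mollify {ρ : Pt N → ℝ} (hρ : ContDiff ℝ ∞ ρ) (hρc : HasCompactSupport ρ)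
    {g : Pt N → ℝ} (hg : LocallyIntegrable g volume) : ContDiff ℝ ∞ (mollify ρ g) := by
  have h := hρc.contDiff_convolution_right (ContinuousLinearMap.mul ℝ ℝ) hg (n := ⊤) hρ
  convert h using 1
  ext z
  simp [mollify, convolution, mul_comm]

theorem fderiv_mollify {ρ : Pt N → ℝ} (hρ : ContDiff ℝ ∞ ρ) (hρc : HasCompactSupport ρ)
    {g : Pt N → ℝ} (hg : LocallyIntegrable g volume) (z e : Pt N) :
    fderiv ℝ (mollify ρ g) z e = ∫ t, g t * fderiv ℝ ρ (z - t) e := by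
  have h := hρc.hasFDerivAt_convolution_right (ContinuousLinearMap.mul ℝ ℝ) hg
    (hρ.of_le (by simp)) z
  have h1 : (mollify ρ g) = (convolution g ρ (ContinuousLinearMap.mul ℝ ℝ) volume) := by
    ext z
    simp [mollify, convolution, mul_comm]
  rw [h1, h.fderiv, convolution, ContinuousLinearMap.integral_apply]
  · simp
  · exact (hρc.fderiv (𝕜 := ℝ)).convolutionExists_right
      ((ContinuousLinearMap.mul ℝ ℝ).precompR (Pt N)) hg (hρ.continuous_fderiv (by simp)) z

/-- If the mollifier is supported below the boundary, then the mollification of the extension by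
zero of `v` only sees, near a point of the half-space, values of `v` in the half-space,
so its gradient there is the mollification of the weak gradient. -/
theorem classicalGrad_mollify {ρ : Pt N → ℝ} (hρ : ContDiff ℝ ∞ ρ) (hρc : HasCompactSupport ρ)
    (hρs : ∀ h ∈ tsupport ρ, h.2 < 0) {v : Pt N → ℝ} {G : Pt N → Vec N} (hvG : IsWeakGrad v G)
    {v₀ : Pt N → ℝ} {G₀ : Pt N → Vec N} (hv₀ : MemLp v₀ 2 volume) (hG₀ : MemLp G₀ 2 volume)
    (hv : v₀ =ᵐ[volume] (halfSpace N).indicator v) (hG : G₀ =ᵐ[volume] (halfSpace N).indicator G)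
    {z : Pt N} (hz : z ∈ halfSpace N) :
    classicalGrad (mollify ρ v₀) z = mollify ρ G₀ z := by
  have hli : LocallyIntegrable v₀ volume := hv₀.locallyIntegrable (by norm_num)
  have hms := measurableSet_halfSpace N
  let φ : Pt N → ℝ := fun t => ρ (z - t)
  have hφ : ContDiff ℝ ∞ φ := hρ.comp (contDiff_const.sub contDiff_id)
  have hφc : HasCompactSupport φ := hρc.comp_homeomorph (Homeomorph.subLeft z)
  have hφs : tsupport φ ⊆ halfSpace N := by
    intro t ht
    have h1 : z - t ∈ tsupport ρ :=
      tsupport_comp_subset_preimage ρ (f := fun t => z - t) (by fun_prop) ht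
    have h2 := hρs _ h1
    have h3 : 0 < z.2 := hz
    simp only [Prod.snd_sub] at h2
    change 0 < t.2
    linarith
  have hφG : Integrable (fun t => φ t • G₀ t) :=
    memLp_one_iff_integrable.1
      (hG₀.smul (hφ.continuous.memLp_of_hasCompactSupport (p := 2) hφc))
  have hw := hvG.integral_eq φ hφ hφc hφs
  have e1 : ∫ t, v t • classicalGrad φ t ∂(halfMeasure N) = ∫ t, v₀ t • classicalGrad φ t := by
    rw [halfMeasure, ← integral_indicator hms]
    refine integral_congr_ae ?_
    filter_upwards [hv] with t ht
    rw [ht]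
    by_cases h : t ∈ halfSpace N <;> simp [h]
  have e2 : ∫ t, φ t • G t ∂(halfMeasure N) = ∫ t, φ t • G₀ t := by
    rw [halfMeasure, ← integral_indicator hms]
    refine integral_congr_ae ?_
    filter_upwards [hG] with t ht
    rw [ht]
    by_cases h : t ∈ halfSpace N <;> simp [h]
  rw [e1, e2] at hw
  have hvφ : Integrable (fun t => v₀ t • classicalGrad φ t) :=
    memLp_one_iff_integrable.1 (MemLp.smul
      ((contDiff_classicalGrad hφ).continuous.memLp_of_hasCompactSupport (p := 2)
        (hasCompactSupport_classicalGrad hφ hφc)) hv₀)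
  refine ext_inner_right ℝ fun e => ?_
  rw [inner_classicalGrad ((contDiff_mollify hρ hρc hli).differentiable (by simp) z),
    fderiv_mollify hρ hρc hli]
  have hmol : mollify ρ G₀ z = - ∫ t, v₀ t • classicalGrad φ t := by
    rw [hw, neg_neg]; rfl
  rw [hmol, inner_neg_left, real_inner_comm, ← integral_inner hvφ, ← integral_neg]
  refine integral_congr_ae (ae_of_all _ fun t => ?_)
  have hd : fderiv ℝ φ t = - fderiv ℝ ρ (z - t) := by
    have h1 : HasFDerivAt φ ((fderiv ℝ ρ (z - t)).comp (-ContinuousLinearMap.id ℝ (Pt N))) t :=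
      HasFDerivAt.comp t (hρ.differentiable (by simp) (z - t)).hasFDerivAt
        ((hasFDerivAt_id t).const_sub z)
    rw [h1.fderiv]
    ext <;> simp
  simp only
  rw [inner_smul_right, real_inner_comm, inner_classicalGrad (hφ.differentiable (by simp) t), hd]
  simp

/-- A strongly measurable version of the extension by zero to the whole space. -/
theorem exists_zeroExtension {E : Type*} [NormedAddCommGroup E] {g : Pt N → E}
    (hg : MemLp g 2 (halfMeasure N)) :
    ∃ g₀ : Pt N → E, StronglyMeasurable g₀ ∧ MemLp g₀ 2 volume ∧
      g₀ =ᵐ[volume] (halfSpace N).indicator g ∧ g₀ =ᵐ[halfMeasure N] g := by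
  have hms := measurableSet_halfSpace N
  have h1 : MemLp ((halfSpace N).indicator g) 2 volume := (memLp_indicator_iff_restrict hms).2 hg
  refine ⟨h1.1.mk _, h1.1.stronglyMeasurable_mk, h1.ae_eq h1.1.ae_eq_mk, h1.1.ae_eq_mk.symm, ?_⟩
  have h2 : h1.1.mk _ =ᵐ[halfMeasure N] (halfSpace N).indicator g :=
    ae_restrict_of_ae h1.1.ae_eq_mk.symm
  exact h2.trans (indicator_ae_eq_restrict hms)

/-- A mollifier supported in a small ball strictly below the boundary. Convolution with it averages
over points that lie higher up. -/
theorem exists_mollifier_below (N : ℕ) {δ : ℝ} (hδ : 0 < δ) :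
    ∃ ρ : Pt N → ℝ, ContDiff ℝ ∞ ρ ∧ HasCompactSupport ρ ∧ (∀ h, 0 ≤ ρ h) ∧ ∫ h, ρ h = 1 ∧
      (∀ h ∈ tsupport ρ, h.2 < 0) ∧ ∀ h, ρ h ≠ 0 → ‖h‖ < δ := by
  -- a bump of radius `δ / 4` centred at distance `δ / 2` below the origin
  let c : Pt N := (0, -(δ / 2))
  let b : ContDiffBump c := ⟨δ / 8, δ / 4, by positivity, by linarith⟩
  have hball : ∀ t ∈ tsupport (b.normed volume), dist t c ≤ δ / 4 := fun t ht => by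
    rw [b.tsupport_normed_eq] at ht
    exact ht
  refine ⟨b.normed volume, b.contDiff_normed (n := ⊤), b.hasCompactSupport_normed,
    b.nonneg_normed, b.integral_normed, fun t ht => ?_, fun t ht => ?_⟩
  · have h1 : dist t.2 c.2 ≤ δ / 4 := (le_max_right _ _).trans (hball t ht)
    rw [Real.dist_eq] at h1
    have := (abs_le.1 h1).2
    simp only [c] at this
    linarith
  · have h1 := hball t (subset_tsupport _ ht)
    have h2 : ‖c‖ = δ / 2 := by
      simp [c, Prod.norm_def, abs_of_pos hδ]
      positivity
    have h3 : ‖t‖ ≤ ‖t - c‖ + ‖c‖ := by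
      simpa using norm_add_le (t - c) c
    rw [dist_eq_norm] at h1
    linarith

theorem exists_smooth_cutoff (N : ℕ) :
    ∃ β : Pt N → ℝ, ContDiff ℝ ∞ β ∧ HasCompactSupport β ∧ (∀ z, 0 ≤ β z) ∧ (∀ z, β z ≤ 1) ∧
      β 0 = 1 := by
  let b : ContDiffBump (0 : Pt N) := ⟨1, 2, one_pos, one_lt_two⟩
  exact ⟨b, b.contDiff, b.hasCompactSupport, fun _ => b.nonneg, fun _ => b.le_one,
    b.one_of_mem_closedBall (Metric.mem_closedBall_self zero_le_one)⟩

theorem IsWeakGrad.exists_smooth_close {v : Pt N → ℝ} {G : Pt N → Vec N} (h : IsWeakGrad v G)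
    {κ : ℝ≥0∞} (hκ : κ ≠ 0) :
    ∃ w : Pt N → ℝ, ContDiff ℝ ∞ w ∧ eLpNorm (fun z => w z - v z) 2 (halfMeasure N) ≤ κ ∧
      eLpNorm (fun z => classicalGrad w z - G z) 2 (halfMeasure N) ≤ κ := by
  obtain ⟨v₀, hv₀m, hv₀, hv, hv'⟩ := exists_zeroExtension h.memLp_fun
  obtain ⟨G₀, hG₀m, hG₀, hG, hG'⟩ := exists_zeroExtension h.memLp_grad
  obtain ⟨δ₁, hδ₁, t₁⟩ := exists_translation_close hv₀ hκ
  obtain ⟨δ₂, hδ₂, t₂⟩ := exists_translation_close hG₀ hκ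
  obtain ⟨ρ, hρ, hρc, hρ0, hρ1, hs, hn⟩ := exists_mollifier_below N (lt_min hδ₁ hδ₂)
  have m1 := eLpNorm_mollify_sub_le hρ.continuous hρc hρ0 hρ1
    hv₀m hv₀ (κ := κ) fun t ht => t₁ t ((hn t ht).trans_le (min_le_left _ _))
  have m2 := eLpNorm_mollify_sub_le hρ.continuous hρc hρ0 hρ1
    hG₀m hG₀ (κ := κ) fun t ht => t₂ t ((hn t ht).trans_le (min_le_right _ _))
  refine ⟨mollify ρ v₀, contDiff_mollify hρ hρc (hv₀.locallyIntegrable (by norm_num)), ?_, ?_⟩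
  · refine le_trans (le_of_eq (eLpNorm_congr_ae ?_))
      ((eLpNorm_mono_measure _ Measure.restrict_le_self).trans m1)
    filter_upwards [hv'] with z hz
    rw [hz]
  · refine le_trans (le_of_eq (eLpNorm_congr_ae ?_))
      ((eLpNorm_mono_measure _ Measure.restrict_le_self).trans m2)
    filter_upwards [hG', ae_restrict_mem (measurableSet_halfSpace N)] with z hz hz'
    rw [hz, classicalGrad_mollify hρ hρc hs h hv₀ hG₀ hv hG hz']

theorem exists_compactSupport_close {W : Pt N → ℝ} (hW : ContDiff ℝ ∞ W)
    (h1 : MemLp W 2 (halfMeasure N)) (h2 : MemLp (classicalGrad W) 2 (halfMeasure N))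
    {κ : ℝ≥0∞} (hκ : κ ≠ 0) :
    ∃ w : Pt N → ℝ, ContDiff ℝ ∞ w ∧ HasCompactSupport w ∧
      eLpNorm (fun z => w z - W z) 2 (halfMeasure N) ≤ κ ∧
      eLpNorm (fun z => classicalGrad w z - classicalGrad W z) 2 (halfMeasure N) ≤ κ := by
  obtain ⟨b, hb, hbc, hb0, hb1, hb00⟩ := exists_smooth_cutoff N
  let a : ℕ → ℝ := fun n => 1 / ((n : ℝ) + 1)
  have ha : ∀ n, 0 < a n := fun n => by simp only [a]; positivity
  have ha1 : ∀ n, a n ≤ 1 := fun n => by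
    simp only [a]; rw [div_le_one (by positivity)]; linarith [n.cast_nonneg (α := ℝ)]
  have hat : Tendsto a atTop (𝓝 0) := tendsto_one_div_add_atTop_nhds_zero_nat
  let χ : ℕ → Pt N → ℝ := fun n z => b (a n • z)
  have hχ : ∀ n, ContDiff ℝ ∞ (χ n) := fun n => hb.comp (contDiff_const_smul _)
  have hχc : ∀ n, HasCompactSupport (χ n) := fun n =>
    hbc.comp_smul (ha n).ne'
  have hχb : ∀ n z, |χ n z - 1| ≤ 1 := fun n z => by
    have := hb0 (a n • z)
    have := hb1 (a n • z)
    rw [abs_le]; constructor <;> simp only [χ] <;> linarith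
  obtain ⟨M, hM⟩ : ∃ M : ℝ, ∀ z, ‖classicalGrad b z‖ ≤ M :=
    (contDiff_classicalGrad hb).continuous.bounded_above_of_compact_support
      (hasCompactSupport_classicalGrad hb hbc)
  have hM0 : 0 ≤ M := (norm_nonneg _).trans (hM 0)
  have hχg : ∀ n z, classicalGrad (χ n) z = a n • classicalGrad b (a n • z) := fun n z => by
    have hd : HasFDerivAt (χ n) ((fderiv ℝ b (a n • z)).comp
        (a n • ContinuousLinearMap.id ℝ (Pt N))) z :=
      HasFDerivAt.comp z (hb.differentiable (by simp) (a n • z)).hasFDerivAt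
        ((hasFDerivAt_id z).const_smul (a n))
    rw [classicalGrad_eq hd.differentiableAt, classicalGrad_eq (hb.differentiable (by simp) _),
      hd.fderiv, ← map_smul]
    congr 1
    ext <;> simp
  have hχt : ∀ z, Tendsto (fun n => χ n z) atTop (𝓝 1) := fun z => by
    have h3 : Tendsto (fun n => a n • z) atTop (𝓝 0) := by
      simpa using hat.smul_const z
    have h4 := (hb.continuous.tendsto 0).comp h3
    rwa [hb00] at h4
  have c1 : Tendsto (fun n => eLpNorm (fun z => χ n z * W z - W z) 2 (halfMeasure N))
      atTop (𝓝 0) := by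
    refine tendsto_eLpNorm_two_zero_of_dominated (H := fun z => ‖W z‖) (fun n => ?_) h1.norm
      (fun n => ae_of_all _ fun z => ?_) (ae_of_all _ fun z => ?_)
    · exact (((hχ n).continuous.mul hW.continuous).sub hW.continuous).aestronglyMeasurable
    · rw [← sub_one_mul, norm_mul]
      exact mul_le_of_le_one_left (norm_nonneg _) (hχb n z)
    · simpa using ((hχt z).mul_const (W z)).sub_const (W z)
  have hcg : ∀ n z, classicalGrad (fun z => χ n z * W z) z - classicalGrad W z
      = (χ n z - 1) • classicalGrad W z + (W z * a n) • classicalGrad b (a n • z) :=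
    fun n z => by
      rw [classicalGrad_mul ((hχ n).differentiable (by simp) z) (hW.differentiable (by simp) z),
        hχg, sub_smul, one_smul, mul_smul]
      abel
  have c2 : Tendsto (fun n => eLpNorm (fun z => classicalGrad (fun z => χ n z * W z) z
      - classicalGrad W z) 2 (halfMeasure N)) atTop (𝓝 0) := by
    refine tendsto_eLpNorm_two_zero_of_dominated
      (H := fun z => ‖classicalGrad W z‖ + M * ‖W z‖) (fun n => ?_)
      (h2.norm.add (h1.norm.const_mul M)) (fun n => ae_of_all _ fun z => ?_)
      (ae_of_all _ fun z => ?_)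
    · exact ((contDiff_classicalGrad ((hχ n).mul hW)).continuous.sub
        (contDiff_classicalGrad hW).continuous).aestronglyMeasurable
    · rw [hcg]
      refine (norm_add_le _ _).trans (add_le_add ?_ ?_)
      · rw [norm_smul]
        exact mul_le_of_le_one_left (norm_nonneg _) (hχb n z)
      · rw [norm_smul, norm_mul, Real.norm_of_nonneg (ha n).le]
        calc ‖W z‖ * a n * ‖classicalGrad b (a n • z)‖ ≤ ‖W z‖ * 1 * M := by
              gcongr
              · exact ha1 n
              · exact hM _
          _ = _ := by ring
    · simp only [hcg]
      have h3 : Tendsto (fun n => (χ n z - 1) • classicalGrad W z) atTop (𝓝 0) := by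
        simpa using ((hχt z).sub_const 1).smul_const (classicalGrad W z)
      have h4 : Tendsto (fun n => (W z * a n) • classicalGrad b (a n • z)) atTop (𝓝 0) := by
        refine squeeze_zero_norm (a := fun n => ‖W z‖ * a n * M) (fun n => ?_) ?_
        · rw [norm_smul, norm_mul, Real.norm_of_nonneg (ha n).le]
          have := ha n
          gcongr
          exact hM _
        · simpa using (hat.const_mul ‖W z‖).mul_const M
      simpa using h3.add h4
  obtain ⟨n, hn1, hn2⟩ := ((c1.eventually_lt_const (pos_iff_ne_zero.2 hκ)).and
    (c2.eventually_lt_const (pos_iff_ne_zero.2 hκ))).exists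
  exact ⟨fun z => χ n z * W z, (hχ n).mul hW, (hχc n).mul_right, hn1.le, hn2.le⟩

theorem IsWeakGrad.exists_smooth_compactSupport_close {v : Pt N → ℝ} {G : Pt N → Vec N}
    (h : IsWeakGrad v G) {κ : ℝ≥0∞} (hκ : κ ≠ 0) :
    ∃ w : Pt N → ℝ, ContDiff ℝ ∞ w ∧ HasCompactSupport w ∧
      eLpNorm (fun z => w z - v z) 2 (halfMeasure N) ≤ κ ∧
      eLpNorm (fun z => classicalGrad w z - G z) 2 (halfMeasure N) ≤ κ := by
  have hκ2 : min (κ / 2) 1 ≠ 0 := by simp [hκ]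
  obtain ⟨W, hW, a1, a2⟩ := h.exists_smooth_close hκ2
  have hcW : AEStronglyMeasurable W (halfMeasure N) := hW.continuous.aestronglyMeasurable
  have hcG : AEStronglyMeasurable (classicalGrad W) (halfMeasure N) :=
    (contDiff_classicalGrad hW).continuous.aestronglyMeasurable
  have b1 : MemLp (fun z => W z - v z) 2 (halfMeasure N) :=
    ⟨hcW.sub h.memLp_fun.1, a1.trans_lt (min_lt_of_right_lt ENNReal.one_lt_top)⟩
  have b2 : MemLp (fun z => classicalGrad W z - G z) 2 (halfMeasure N) :=
    ⟨hcG.sub h.memLp_grad.1, a2.trans_lt (min_lt_of_right_lt ENNReal.one_lt_top)⟩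
  have hW1 : MemLp W 2 (halfMeasure N) :=
    (b1.add h.memLp_fun).ae_eq (ae_of_all _ fun z => by simp)
  have hW2 : MemLp (classicalGrad W) 2 (halfMeasure N) :=
    (b2.add h.memLp_grad).ae_eq (ae_of_all _ fun z => by simp)
  obtain ⟨w, hw, hwc, d1, d2⟩ := exists_compactSupport_close hW hW1 hW2 hκ2
  have hm : min (κ / 2) 1 + min (κ / 2) 1 ≤ κ :=
    (add_le_add (min_le_left _ _) (min_le_left _ _)).trans (ENNReal.add_halves κ).le
  refine ⟨w, hw, hwc, ?_, ?_⟩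
  · refine le_trans ?_ ((add_le_add d1 a1).trans hm)
    refine le_trans (le_of_eq ?_) (eLpNorm_add_le
      (hw.continuous.aestronglyMeasurable.sub hcW) b1.1 (by norm_num))
    congr 1; ext1 z; simp
  · refine le_trans ?_ ((add_le_add d2 a2).trans hm)
    refine le_trans (le_of_eq ?_) (eLpNorm_add_le
      ((contDiff_classicalGrad hw).continuous.aestronglyMeasurable.sub hcG) b2.1 (by norm_num))
    congr 1; ext1 z; simp

theorem eLpNorm_sub_le_of_close {α E : Type*} {mα : MeasurableSpace α} {μ : Measure α}
    [NormedAddCommGroup E] {f g h : α → E} {a b : ℝ≥0∞}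
    (hf : AEStronglyMeasurable f μ) (hg : AEStronglyMeasurable g μ)
    (hh : AEStronglyMeasurable h μ)
    (h1 : eLpNorm (fun z => f z - h z) 2 μ ≤ a) (h2 : eLpNorm (fun z => g z - h z) 2 μ ≤ b) :
    eLpNorm (fun z => f z - g z) 2 μ ≤ a + b := by
  refine le_trans (le_of_eq ?_) ((eLpNorm_sub_le (hf.sub hh) (hg.sub hh) (by norm_num)).trans
    (add_le_add h1 h2))
  congr 1; ext1 z; simp

/-- Existence of traces. -/
theorem IsWeakGrad.exists_isTrace {v : Pt N → ℝ} {G : Pt N → Vec N} (h : IsWeakGrad v G) :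
    ∃ u : EuclideanSpace ℝ (Fin N) → ℝ, IsTrace v u := by
  let B : ℕ → ℝ≥0∞ := fun n => (1 / 2) ^ n
  have hB0 : ∀ n, B n ≠ 0 := fun n => by simp [B]
  have hBt : ∀ n, B n ≠ ⊤ := fun n => by simp only [B]; finiteness
  have hBs : ∑' n, B n ≠ ⊤ := by simp [B, ENNReal.tsum_geometric]
  have hBm : ∀ {m n}, m ≤ n → B n ≤ B m := fun hmn =>
    pow_le_pow_of_le_one zero_le (by simp) hmn
  have hBl : Tendsto B atTop (𝓝 0) :=
    ENNReal.tendsto_pow_atTop_nhds_zero_of_lt_one (by simp)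
  have hκ : ∀ n, B n / 2 / 2 ≠ 0 := fun n => by simp [hB0 n]
  choose w hw hwc c1 c2 using fun n => h.exists_smooth_compactSupport_close (hκ n)
  have hlim : Tendsto (fun n => B n / 2 / 2) atTop (𝓝 0) := by
    simpa using ENNReal.Tendsto.div_const (ENNReal.Tendsto.div_const hBl
      (Or.inr (two_ne_zero' ℝ≥0∞))) (Or.inr (two_ne_zero' ℝ≥0∞))
  have hwm : ∀ n, AEStronglyMeasurable (w n) (halfMeasure N) := fun n =>
    (hw n).continuous.aestronglyMeasurable
  have hgm : ∀ n, AEStronglyMeasurable (classicalGrad (w n)) (halfMeasure N) := fun n =>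
    (contDiff_classicalGrad (hw n)).continuous.aestronglyMeasurable
  have htm : ∀ n, MemLp (fun x : EuclideanSpace ℝ (Fin N) => w n (x, 0)) 2 volume := fun n =>
    memLp_boundary_of_contDiff (hw n) (hwc n)
  have hcau : ∀ M n m : ℕ, M ≤ n → M ≤ m →
      eLpNorm ((fun x : EuclideanSpace ℝ (Fin N) => w n (x, 0)) - fun x => w m (x, 0)) 2 volume
        < B M := by
    intro M n m hn hm
    have hsum : B n / 2 / 2 + B m / 2 / 2 ≤ B M / 2 := by
      calc B n / 2 / 2 + B m / 2 / 2 ≤ B M / 2 / 2 + B M / 2 / 2 := by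
            gcongr <;> exact hBm ‹_›
        _ = B M / 2 := ENNReal.add_halves _
    have d1 := (eLpNorm_sub_le_of_close (hwm n) (hwm m) h.memLp_fun.1 (c1 n) (c1 m)).trans hsum
    have d2 := (eLpNorm_sub_le_of_close (hgm n) (hgm m) h.memLp_grad.1 (c2 n) (c2 m)).trans hsum
    have t := eLpNorm_trace_two_sq_le ((hw n).sub (hw m)) ((hwc n).sub (hwc m))
    have eg : classicalGrad (fun z => w n z - w m z)
        = fun z => classicalGrad (w n) z - classicalGrad (w m) z := funext fun z =>
      classicalGrad_sub ((hw n).differentiable (by simp) z) ((hw m).differentiable (by simp) z)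
    have ht : eLpNorm (fun x : EuclideanSpace ℝ (Fin N) => w n (x, 0) - w m (x, 0)) 2 volume ^ 2
        ≤ 2 * (B M / 2 * (B M / 2)) := by
      refine t.trans ?_
      rw [eg]
      gcongr
    by_contra! hcon
    have h3 : B M * B M ≤ B M * (B M / 2) :=
      calc B M * B M = B M ^ 2 := (pow_two _).symm
        _ ≤ _ := pow_le_pow_left₀ zero_le hcon 2
        _ ≤ _ := ht
        _ = _ := by rw [← mul_assoc, ENNReal.mul_div_cancel two_ne_zero (by simp)]
    rw [ENNReal.mul_le_mul_iff_right (hB0 M) (hBt M)] at h3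
    exact absurd h3 (not_le.2 (ENNReal.half_lt_self (hB0 M) (hBt M)))
  obtain ⟨u, hu, hlimu⟩ := Lp.cauchy_complete_eLpNorm (by norm_num) htm hBs hcau
  refine ⟨u, hu.1, G, h, w, fun n => ⟨hw n, hwc n⟩, ?_, ?_, hlimu⟩
  · exact tendsto_of_tendsto_of_tendsto_of_le_of_le tendsto_const_nhds hlim (fun _ => zero_le) c1
  · exact tendsto_of_tendsto_of_tendsto_of_le_of_le tendsto_const_nhds hlim (fun _ => zero_le) c2

end Density

/-! ### De Giorgi iteration -/

section DeGiorgi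

/-- A sequence with a recursion that is superlinear (`1 < α`) up to factors growing geometrically
tends to zero, provided that the constant is small; here it is made small by taking `K` large. -/
theorem exists_tendsto_zero_of_superlinear {α q d C I : ℝ} (hα : 1 < α) (hq : 0 < q) (hd : 0 < d)
    (hI : 0 < I) (hC : 0 ≤ C) :
    ∃ K₀ : ℝ, ∀ K, K₀ ≤ K → 0 < K → ∀ z : ℕ → ℝ, (∀ n, 0 ≤ z n) → z 0 ≤ I →
      (∀ n, z (n + 1) ≤ C * ((16 * 2 ^ n) ^ q * K ^ (-d) * z n) ^ α) →
      Tendsto z atTop (𝓝 0) := by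
  let b : ℝ := ((2 : ℝ) ^ q) ^ α
  let r : ℝ := b ^ (-(1 / (α - 1)))
  have hα0 : α - 1 ≠ 0 := by linarith
  have hb : 1 < b := Real.one_lt_rpow (Real.one_lt_rpow (by norm_num) hq) (by linarith)
  have hb0 : 0 < b := by linarith
  have hr0 : 0 < r := Real.rpow_pos_of_pos hb0 _
  have hr1 : r < 1 := Real.rpow_lt_one_of_one_lt_of_neg hb
    (neg_neg_of_pos (one_div_pos.2 (by linarith)))
  -- the ratio `r` is chosen so that `n ↦ I * r ^ n` is compatible with the recursion
  have hbr : b * r ^ α = r := by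
    have h1 : r ^ α = r ^ (α - 1) * r := by
      rw [← Real.rpow_add_one hr0.ne']; congr 1; ring
    have h2 : r ^ (α - 1) = b⁻¹ := by
      rw [← Real.rpow_mul hb0.le, neg_mul, one_div_mul_cancel hα0, Real.rpow_neg_one]
    rw [h1, h2, ← mul_assoc, mul_inv_cancel₀ hb0.ne', one_mul]
  have hlim : Tendsto (fun K : ℝ => C * ((16 : ℝ) ^ q * K ^ (-d)) ^ α * I ^ (α - 1)) atTop
      (𝓝 0) := by
    have h1 := ((tendsto_rpow_neg_atTop hd).const_mul ((16 : ℝ) ^ q)).rpow_const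
      (p := α) (Or.inr (by linarith))
    rw [mul_zero, Real.zero_rpow (by linarith)] at h1
    simpa using (h1.const_mul C).mul_const (I ^ (α - 1))
  obtain ⟨K₀, hK₀⟩ := eventually_atTop.1 (hlim.eventually_le_const hr0)
  refine ⟨K₀, fun K hK hKpos z hz hz0 hrec => ?_⟩
  have hsmall := hK₀ K hK
  have hbound : ∀ n, z n ≤ I * r ^ n := by
    intro n
    induction n with
    | zero => simpa using hz0
    | succ n ih =>
      have e1 : ((16 : ℝ) * 2 ^ n) ^ q = 16 ^ q * (2 ^ q) ^ n := by
        rw [Real.mul_rpow (by norm_num) (by positivity), ← Real.rpow_natCast,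
          ← Real.rpow_natCast, ← Real.rpow_mul (by norm_num), ← Real.rpow_mul (by norm_num),
          mul_comm q]
      have e2 : ∀ x : ℝ, 0 ≤ x → (x ^ n) ^ α = (x ^ α) ^ n := fun x hx => by
        rw [← Real.rpow_natCast, ← Real.rpow_natCast, ← Real.rpow_mul hx, ← Real.rpow_mul hx,
          mul_comm]
      have e3 : I ^ α = I ^ (α - 1) * I := by
        rw [← Real.rpow_add_one hI.ne']; congr 1; ring
      have hK0 : 0 ≤ K ^ (-d) := by positivity
      calc z (n + 1) ≤ C * ((16 * 2 ^ n) ^ q * K ^ (-d) * z n) ^ α := hrec n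
        _ ≤ C * ((16 * 2 ^ n) ^ q * K ^ (-d) * (I * r ^ n)) ^ α := by
            have := hz n
            gcongr
        _ = C * ((16 ^ q * K ^ (-d)) * (2 ^ q) ^ n * (I * r ^ n)) ^ α := by
            rw [e1]; congr 2; ring
        _ = C * ((16 ^ q * K ^ (-d)) ^ α * b ^ n * (I ^ (α - 1) * I * (r ^ α) ^ n)) := by
            rw [Real.mul_rpow (by positivity) (by positivity),
              Real.mul_rpow (by positivity) (by positivity),
              Real.mul_rpow hI.le (by positivity), e2 _ (by positivity), e2 _ hr0.le, e3]
        _ = (C * (16 ^ q * K ^ (-d)) ^ α * I ^ (α - 1)) * (I * (b * r ^ α) ^ n) := by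
            rw [mul_pow]; ring
        _ ≤ r * (I * (b * r ^ α) ^ n) := by gcongr
        _ = I * r ^ (n + 1) := by rw [hbr, pow_succ]; ring
  have hlim0 : Tendsto (fun n => I * r ^ n) atTop (𝓝 0) := by
    simpa using (tendsto_pow_atTop_nhds_zero_of_lt_one hr0.le hr1).const_mul I
  exact squeeze_zero hz hbound hlim0

/-- Above the intermediate level, powers of `s` are controlled by the higher power of the
excess `s - k`. -/
theorem rpow_le_mul_excess_rpow {s K q θ : ℝ} (hK : 0 < K) (hθ : 0 ≤ θ) (hθq : θ ≤ q) (n : ℕ)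
    (hs : K * (2 - 3 / 4 * (1 / 2) ^ n) < s) :
    s ^ θ ≤ (16 * 2 ^ n) ^ q * K ^ (-(q - θ)) * (s - K * (2 - (1 / 2) ^ n)) ^ q := by
  set a : ℝ := 2 ^ n with ha
  have ha1 : 1 ≤ a := one_le_pow₀ (by norm_num)
  have ha0 : 0 < a := by linarith
  have hinv : ((1 : ℝ) / 2) ^ n = a⁻¹ := by rw [ha, one_div, inv_pow]
  rw [hinv] at hs ⊢
  set T := s - K * (2 - a⁻¹) with hT
  have hKa : 0 < K * a⁻¹ := by positivity
  have hT1 : K * (4 * a)⁻¹ ≤ T := by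
    rw [mul_inv, hT]
    linarith
  have hT0 : 0 < T := lt_of_lt_of_le (by positivity) hT1
  have hKT : K ≤ 4 * a * T := by
    rw [← div_eq_mul_inv, div_le_iff₀ (by positivity)] at hT1
    linarith
  have hsT : s ≤ 16 * a * T := by
    have h1 : s ≤ T + 2 * K := by rw [hT]; linarith
    have h2 : T ≤ a * T := le_mul_of_one_le_left hT0.le ha1
    linarith
  have hs0 : 0 ≤ s := by
    have h1 : K * a⁻¹ ≤ K * 1 := by gcongr; exact inv_le_one_of_one_le₀ ha1
    have h2 : s = T + K * (2 - a⁻¹) := by rw [hT]; ring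
    linarith
  have hr : 1 ≤ (16 * a * T / K) ^ (q - θ) := by
    refine Real.one_le_rpow ?_ (by linarith)
    rw [le_div_iff₀ hK]
    have : 0 < a * T := by positivity
    linarith
  calc s ^ θ ≤ (16 * a * T) ^ θ := Real.rpow_le_rpow hs0 hsT hθ
    _ ≤ (16 * a * T) ^ θ * (16 * a * T / K) ^ (q - θ) :=
        le_mul_of_one_le_right (by positivity) hr
    _ = (16 * a * T) ^ q * K ^ (-(q - θ)) := by
        rw [Real.div_rpow (by positivity) hK.le, Real.rpow_neg hK.le, div_eq_mul_inv,
          ← mul_assoc, ← Real.rpow_add (by positivity)]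
        congr 2; ring
    _ = _ := by
        rw [Real.mul_rpow (x := 16 * a) (by positivity) hT0.le]; ring

/-- De Giorgi's lemma: if the `L^q` norm of the excess of `|u|` over a level is controlled by
the integral of `|u|^θ` over a lower superlevel set, with `2 < q` and `θ < q`, then `u` is
essentially bounded. -/
theorem exists_ae_bound_of_levels {α : Type*} {mα : MeasurableSpace α} {μ : Measure α}
    {u : α → ℝ} (hu : AEStronglyMeasurable u μ) {q θ M : ℝ} (hq : 2 < q) (hθ : 0 < θ)
    (hθq : θ < q) {C : ℝ≥0∞} (hC : C ≠ ⊤) (huq : ∫⁻ x, ‖u x‖ₑ ^ q ∂μ ≠ ⊤)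
    (hlev : ∀ m k : ℝ, 0 < m → M ≤ m → m < k →
      ∫⁻ x, ENNReal.ofReal (|u x| - k) ^ q ∂μ
        ≤ C * (∫⁻ x, {x | m < |u x|}.indicator (fun x => ‖u x‖ₑ ^ θ) x ∂μ) ^ (q / 2)) :
    ∃ K : ℝ, ∀ᵐ x ∂μ, ‖u x‖ ≤ K := by
  have hq0 : 0 < q := by linarith
  set I : ℝ := (∫⁻ x, ‖u x‖ₑ ^ q ∂μ).toReal + 1 with hI
  have hIpos : 0 < I := by positivity
  obtain ⟨K₀, hK₀⟩ := exists_tendsto_zero_of_superlinear (α := q / 2) (q := q) (d := q - θ)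
    (C := C.toReal) (by linarith) hq0 (by linarith) hIpos ENNReal.toReal_nonneg
  let K : ℝ := max (max K₀ M) 1
  have hKK₀ : K₀ ≤ K := (le_max_left _ _).trans (le_max_left _ _)
  have hKM : M ≤ K := (le_max_right _ _).trans (le_max_left _ _)
  have hKpos : 0 < K := lt_of_lt_of_le one_pos (le_max_right _ _)
  -- the levels increase from `K` to `2 * K`; the intermediate levels are `K * (2 - 3 / 4 * 2⁻ⁿ)`
  let k : ℕ → ℝ := fun n => K * (2 - (1 / 2) ^ n)
  let Z : ℕ → ℝ≥0∞ := fun n => ∫⁻ x, ENNReal.ofReal (|u x| - k n) ^ q ∂μ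
  have hpow : ∀ n : ℕ, 0 < ((1 : ℝ) / 2) ^ n ∧ ((1 : ℝ) / 2) ^ n ≤ 1 := fun n =>
    ⟨by positivity, pow_le_one₀ (by norm_num) (by norm_num)⟩
  have hk0 : ∀ n, 0 ≤ k n := fun n => mul_nonneg hKpos.le (by linarith [(hpow n).2])
  have hZI : ∀ n, Z n ≤ ∫⁻ x, ‖u x‖ₑ ^ q ∂μ := fun n => by
    refine lintegral_mono fun x => ENNReal.rpow_le_rpow ?_ hq0.le
    rw [← ofReal_norm, Real.norm_eq_abs]
    exact ENNReal.ofReal_le_ofReal (by linarith [hk0 n])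
  have hZt : ∀ n, Z n ≠ ⊤ := fun n => ne_top_of_le_ne_top huq (hZI n)
  have hrec : ∀ n, Z (n + 1)
      ≤ C * (ENNReal.ofReal ((16 * 2 ^ n) ^ q * K ^ (-(q - θ))) * Z n) ^ (q / 2) := by
    intro n
    obtain ⟨p1, p2⟩ := hpow n
    have hm : K ≤ K * (2 - 3 / 4 * (1 / 2) ^ n) :=
      le_mul_of_one_le_right hKpos.le (by linarith)
    refine (hlev (K * (2 - 3 / 4 * (1 / 2) ^ n)) (k (n + 1)) (by linarith) (by linarith)
      ?_).trans ?_
    · refine mul_lt_mul_of_pos_left ?_ hKpos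
      rw [pow_succ]; linarith
    · refine mul_le_mul_right (ENNReal.rpow_le_rpow ?_ (by linarith)) _
      rw [← lintegral_const_mul' _ _ ENNReal.ofReal_ne_top]
      refine lintegral_mono fun x => ?_
      by_cases hx : K * (2 - 3 / 4 * (1 / 2) ^ n) < |u x|
      · rw [Set.indicator_of_mem (show x ∈ {x | _ < |u x|} from hx)]
        have h := rpow_le_mul_excess_rpow hKpos hθ.le hθq.le n hx
        have hT : 0 ≤ |u x| - k n := by
          have : k n ≤ K * (2 - 3 / 4 * (1 / 2) ^ n) := by
            simp only [k]; gcongr; linarith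
          linarith
        rw [← ofReal_norm, Real.norm_eq_abs, ENNReal.ofReal_rpow_of_nonneg (abs_nonneg _) hθ.le,
          ENNReal.ofReal_rpow_of_nonneg hT hq0.le, ← ENNReal.ofReal_mul (by positivity)]
        exact ENNReal.ofReal_le_ofReal h
      · rw [Set.indicator_of_notMem (show x ∉ {x | _ < |u x|} from hx)]
        exact zero_le
  have htend := hK₀ K hKK₀ hKpos (fun n => (Z n).toReal) (fun n => ENNReal.toReal_nonneg)
    (by
      have := ENNReal.toReal_mono huq (hZI 0)
      linarith)
    (fun n => by
      have h1 : C * (ENNReal.ofReal ((16 * 2 ^ n) ^ q * K ^ (-(q - θ))) * Z n) ^ (q / 2) ≠ ⊤ := by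
        have := hZt n
        have : 0 ≤ q / 2 := by linarith
        finiteness
      have h2 := ENNReal.toReal_mono h1 (hrec n)
      rwa [ENNReal.toReal_mul, ← ENNReal.toReal_rpow, ENNReal.toReal_mul,
        ENNReal.toReal_ofReal (by positivity)] at h2)
  have hle : ∀ n, ∫⁻ x, ENNReal.ofReal (|u x| - 2 * K) ^ q ∂μ ≤ Z n := fun n => by
    refine lintegral_mono fun x => ENNReal.rpow_le_rpow (ENNReal.ofReal_le_ofReal ?_) hq0.le
    have : k n ≤ K * 2 := by simp only [k]; gcongr; linarith [(hpow n).1]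
    linarith
  have hz : ∫⁻ x, ENNReal.ofReal (|u x| - 2 * K) ^ q ∂μ = 0 := by
    have h1 : Tendsto Z atTop (𝓝 0) := by
      have := (ENNReal.tendsto_toReal_iff hZt ENNReal.zero_ne_top).1
        (by simpa using htend)
      exact this
    exact le_antisymm (ge_of_tendsto' h1 hle) zero_le
  have hmeas : AEMeasurable (fun x => ENNReal.ofReal (|u x| - 2 * K) ^ q) μ :=
    ((hu.aemeasurable.abs.sub_const _).ennreal_ofReal).pow_const q
  refine ⟨2 * K, ?_⟩
  filter_upwards [(lintegral_eq_zero_iff' hmeas).1 hz] with x hx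
  have h1 : ENNReal.ofReal (|u x| - 2 * K) = 0 := by
    simpa [ENNReal.rpow_eq_zero_iff, hq0, hq0.not_gt] using hx
  rw [ENNReal.ofReal_eq_zero] at h1
  rw [Real.norm_eq_abs]
  linarith

theorem memLp_of_memLp_two_of_ae_bound {α : Type*} {mα : MeasurableSpace α} {μ : Measure α}
    {u : α → ℝ} (hu : MemLp u 2 μ) {K : ℝ} (hK : ∀ᵐ x ∂μ, ‖u x‖ ≤ K) {p : ℝ≥0∞} (hp : 2 ≤ p) :
    MemLp u p μ := by
  rcases eq_or_ne p ⊤ with rfl | hpt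
  · exact memLp_top_of_bound hu.1 K hK
  have hp0 : p ≠ 0 := (lt_of_lt_of_le (by norm_num) hp).ne'
  have hp2 : 2 ≤ p.toReal := by
    simpa using ENNReal.toReal_mono hpt hp
  refine ⟨hu.1, (eLpNorm_lt_top_iff_lintegral_rpow_enorm_lt_top hp0 hpt).2 ?_⟩
  have h2 : ∫⁻ x, ‖u x‖ₑ ^ 2 ∂μ < ⊤ := by
    rw [← eLpNorm_two_sq]
    exact ENNReal.pow_lt_top hu.2
  calc ∫⁻ x, ‖u x‖ₑ ^ p.toReal ∂μ
      ≤ ∫⁻ x, ENNReal.ofReal K ^ (p.toReal - 2) * ‖u x‖ₑ ^ 2 ∂μ := by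
        refine lintegral_mono_ae ?_
        filter_upwards [hK] with x hx
        have h1 : ‖u x‖ₑ ^ p.toReal = ‖u x‖ₑ ^ (p.toReal - 2) * ‖u x‖ₑ ^ 2 := by
          rw [← ENNReal.rpow_natCast, ← ENNReal.rpow_add_of_nonneg _ _ (by linarith) (by simp)]
          congr 1; push_cast; ring
        rw [h1]
        have h3 : ‖u x‖ₑ ≤ ENNReal.ofReal K := by
          rw [← ofReal_norm]; exact ENNReal.ofReal_le_ofReal hx
        have h4 : 0 ≤ p.toReal - 2 := by linarith
        gcongr
    _ < ⊤ := by
        have : 0 ≤ p.toReal - 2 := by linarith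
        rw [lintegral_const_mul' _ _ (by finiteness)]
        exact ENNReal.mul_lt_top (by finiteness) h2

end DeGiorgi

/-! ### Truncations and the energy estimate -/

section Truncation

theorem contDiff_primitive {g : ℝ → ℝ} (hg : ContDiff ℝ ∞ g) :
    ContDiff ℝ ∞ fun t => ∫ s in (0 : ℝ)..t, g s := by
  refine contDiff_infty_iff_deriv.2 ⟨fun t => ?_, ?_⟩
  · exact (hg.continuous.integral_hasStrictDerivAt 0 t).hasDerivAt.differentiableAt
  · have : deriv (fun t => ∫ s in (0 : ℝ)..t, g s) = g :=
      funext fun t => hg.continuous.deriv_integral g 0 t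
    rwa [this]

theorem primitive_neg_of_even {g : ℝ → ℝ} (hg : ∀ t, g (-t) = g t) (t : ℝ) :
    ∫ s in (0 : ℝ)..(-t), g s = - ∫ s in (0 : ℝ)..t, g s := by
  have h := intervalIntegral.integral_comp_neg (a := 0) (b := t) g
  simp only [hg, neg_zero] at h
  rw [h, intervalIntegral.integral_symm]

/-- Smooth truncations at the levels `m < k`: `ψ` is a smooth version of the signed excess of `|t|`
over a level in between, and `η` is such that `η' = (ψ')²`. Hence testing an equation
with `η(v)` controls the Dirichlet integral of `ψ(v)`. -/
theorem exists_truncation {m k : ℝ} (hm : 0 < m) (hmk : m < k) :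
    ∃ ψ η : ℝ → ℝ, ContDiff ℝ ∞ ψ ∧ ContDiff ℝ ∞ η ∧ ψ 0 = 0 ∧ η 0 = 0 ∧
      (∀ t, |deriv ψ t| ≤ 1) ∧ (∀ t, deriv η t = deriv ψ t ^ 2) ∧
      (∀ t, |t| - k ≤ |ψ t|) ∧ (∀ t, |η t| ≤ |t|) ∧ (∀ t, 0 ≤ t * η t) ∧
      ∀ t, |t| ≤ m → η t = 0 := by
  have hkm : 0 < k ^ 2 - m ^ 2 := by nlinarith
  let g : ℝ → ℝ := fun t => Real.smoothTransition ((t ^ 2 - m ^ 2) / (k ^ 2 - m ^ 2))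
  have hg : ContDiff ℝ ∞ g := Real.smoothTransition.contDiff.comp (by fun_prop)
  have hg2 : ContDiff ℝ ∞ fun t => g t ^ 2 := hg.pow 2
  have hg0 : ∀ t, 0 ≤ g t := fun t => Real.smoothTransition.nonneg _
  have hg1 : ∀ t, g t ≤ 1 := fun t => Real.smoothTransition.le_one _
  have hge : ∀ t, g (-t) = g t := fun t => by simp only [g, neg_sq]
  have hgm : ∀ t, |t| ≤ m → g t = 0 := fun t ht =>
    Real.smoothTransition.zero_of_nonpos
      (div_nonpos_of_nonpos_of_nonneg (by nlinarith [sq_abs t, abs_nonneg t]) hkm.le)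
  have hgk : ∀ t, k ≤ t → g t = 1 := fun t ht =>
    Real.smoothTransition.one_of_one_le (by rw [le_div_iff₀ hkm]; nlinarith)
  have hi : ∀ a b : ℝ, IntervalIntegrable g volume a b := fun a b =>
    hg.continuous.intervalIntegrable a b
  let ψ : ℝ → ℝ := fun t => ∫ s in (0 : ℝ)..t, g s
  let η : ℝ → ℝ := fun t => ∫ s in (0 : ℝ)..t, g s ^ 2
  have dψ : ∀ t, deriv ψ t = g t := fun t => hg.continuous.deriv_integral g 0 t
  have dη : ∀ t, deriv η t = g t ^ 2 := fun t => hg2.continuous.deriv_integral _ 0 t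
  have ψodd : ∀ t, ψ (-t) = - ψ t := primitive_neg_of_even hge
  have ηodd : ∀ t, η (-t) = - η t := primitive_neg_of_even (fun t => by rw [hge])
  have ηpos : ∀ t, 0 ≤ t → 0 ≤ η t := fun t ht =>
    intervalIntegral.integral_nonneg ht fun s _ => sq_nonneg _
  refine ⟨ψ, η, contDiff_primitive hg, contDiff_primitive hg2, by simp [ψ], by simp [η],
    fun t => ?_, fun t => ?_, fun t => ?_, fun t => ?_, fun t => ?_, fun t ht => ?_⟩
  · rw [dψ, abs_of_nonneg (hg0 t)]; exact hg1 t
  · rw [dη, dψ]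
  · have key : ∀ s, 0 ≤ s → s - k ≤ ψ s := fun s hs => by
      rcases le_total s k with h | h
      · exact (by linarith : s - k ≤ 0).trans
          (intervalIntegral.integral_nonneg hs fun s _ => hg0 s)
      · have h1 : ψ s = (∫ s in (0 : ℝ)..k, g s) + ∫ s in k..s, g s :=
          (intervalIntegral.integral_add_adjacent_intervals (hi _ _) (hi _ _)).symm
        have h2 : ∫ s in k..s, g s = s - k := by
          rw [intervalIntegral.integral_congr (g := fun _ => (1 : ℝ)) fun y hy => ?_]
          · simp
          · rw [Set.uIcc_of_le h] at hy
            exact hgk y hy.1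
        have h3 : 0 ≤ ∫ s in (0 : ℝ)..k, g s :=
          intervalIntegral.integral_nonneg (by linarith) fun s _ => hg0 s
        linarith
    rcases le_total 0 t with h | h
    · rw [abs_of_nonneg h]
      exact (key t h).trans (le_abs_self _)
    · rw [abs_of_nonpos h]
      refine (key (-t) (by linarith)).trans ?_
      rw [ψodd]
      exact neg_le_abs _
  · have := intervalIntegral.norm_integral_le_of_norm_le_const (a := 0) (b := t) (C := 1)
      (f := fun s => g s ^ 2) fun s _ => by
        rw [Real.norm_of_nonneg (sq_nonneg _)]
        exact pow_le_one₀ (hg0 s) (hg1 s)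
    simpa using this
  · rcases le_total 0 t with h | h
    · exact mul_nonneg h (ηpos t h)
    · have h1 := ηpos (-t) (by linarith)
      rw [ηodd] at h1
      exact mul_nonneg_of_nonpos_of_nonpos h (by linarith)
  · have : ∫ s in (0 : ℝ)..t, g s ^ 2 = ∫ _ in (0 : ℝ)..t, (0 : ℝ) :=
      intervalIntegral.integral_congr fun s hs => by
        have h1 : |s| ≤ |t| := by
          have := Set.abs_sub_left_of_mem_uIcc hs
          simpa using this
        simp [hgm s (h1.trans ht)]
    simpa [η] using this

end Truncation

section Energy

variable {N : ℕ}

theorem MemH.integrable_weight {v : Pt N → ℝ} (h : MemH v) :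
    Integrable (fun z : Pt N => ‖z.1‖ ^ 2 * v z ^ 2) (halfMeasure N) := by
  obtain ⟨G, hG, hi⟩ := h
  refine (hi.sub (hG.memLp_grad.integrable_norm_pow (p := 2) two_ne_zero)).congr
    (ae_of_all _ fun z => ?_)
  simp

/-- Traces are square integrable. -/
theorem IsSmoothLimit.memLp_trace {v : Pt N → ℝ} {G : Pt N → Vec N}
    {u : EuclideanSpace ℝ (Fin N) → ℝ} (h : IsSmoothLimit v G u) : MemLp u 2 volume := by
  obtain ⟨hv, hG, hu, w, hw, c1, c2, c3⟩ := h
  exact memLp_of_tendsto_eLpNorm hu (fun n => memLp_boundary_of_contDiff (hw n).1 (hw n).2) c3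

/-- The energy estimate: testing the equation with `η(v)`, where `η' = (ψ')²` and `η` vanishes on
`[-m, m]`, bounds the Dirichlet integral of `ψ(v)`. Only values of `f` at `|t| > m` enter, where
the growth condition applies. -/
theorem eLpNorm_grad_truncation_sq_le {f : EuclideanSpace ℝ (Fin N) → ℝ → ℝ} {v : Pt N → ℝ}
    (hv : IsWeakSolution f v) {G : Pt N → Vec N} {u : EuclideanSpace ℝ (Fin N) → ℝ}
    (h : IsSmoothLimit v G u) {θ m : ℝ} (hm : 0 < m)
    (hf : ∀ t x, m < |t| → |f x t| ≤ |t| ^ (θ - 1))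
    {ψ η : ℝ → ℝ} (hψ : ContDiff ℝ ∞ ψ) (hη : ContDiff ℝ ∞ η) (hη0 : η 0 = 0)
    (hψ1 : ∀ t, |deriv ψ t| ≤ 1) (hηψ : ∀ t, deriv η t = deriv ψ t ^ 2)
    (hηle : ∀ t, |η t| ≤ |t|) (hηpos : ∀ t, 0 ≤ t * η t) (hηm : ∀ t, |t| ≤ m → η t = 0) :
    eLpNorm (fun z => deriv ψ (v z) • G z) 2 (halfMeasure N) ^ 2
      ≤ ∫⁻ x, {x | m < |u x|}.indicator (fun x => ‖u x‖ₑ ^ θ) x := by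
  have hG := h.isWeakGrad
  have hη1 : ∀ t, |deriv η t| ≤ 1 := fun t => by
    rw [hηψ, abs_pow]
    exact pow_le_one₀ (abs_nonneg _) (hψ1 t)
  have hφ := h.comp hη hη0 hη1
  have hφG := hφ.isWeakGrad
  have hwv := hv.1.integrable_weight
  have hvm := hG.memLp_fun.1
  have hnm : AEStronglyMeasurable (fun z : Pt N => ‖z.1‖ ^ 2) (halfMeasure N) := by
    have : Continuous fun z : Pt N => ‖z.1‖ ^ 2 := by fun_prop
    exact this.aestronglyMeasurable
  have hηv := hη.continuous.comp_aestronglyMeasurable hvm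
  have hMemH : MemH (fun z => η (v z)) := by
    refine ⟨_, hφG, (hφG.memLp_grad.integrable_norm_pow (p := 2) two_ne_zero).add
      (hwv.mono' (hnm.mul (hηv.pow 2)) (ae_of_all _ fun z => ?_))⟩
    rw [Real.norm_of_nonneg (by positivity)]
    exact mul_le_mul_of_nonneg_left (sq_le_sq.2 (hηle _)) (sq_nonneg _)
  obtain ⟨_, heq⟩ := hv.2 G u hG h.isTrace _ _ _ hMemH hφG hφ.isTrace
  have hinner : ∀ z, inner ℝ (G z) (deriv η (v z) • G z) = ‖deriv ψ (v z) • G z‖ ^ 2 := fun z => by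
    rw [inner_smul_right, real_inner_self_eq_norm_sq, norm_smul, mul_pow, hηψ, Real.norm_eq_abs,
      sq_abs]
  simp only [hinner] at heq
  have hGψ : Integrable (fun z => ‖deriv ψ (v z) • G z‖ ^ 2) (halfMeasure N) :=
    (hG.memLp_grad.mono (((hψ.continuous_deriv (by simp)).comp_aestronglyMeasurable hvm).smul
      hG.memLp_grad.1) (ae_of_all _ fun z => by
        rw [Pi.smul_apply', norm_smul]
        exact mul_le_of_le_one_left (norm_nonneg _) (hψ1 _))).integrable_norm_pow two_ne_zero
  have hw : Integrable (fun z : Pt N => ‖z.1‖ ^ 2 * v z * η (v z)) (halfMeasure N) := by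
    refine hwv.mono' ((hnm.mul hvm).mul hηv) (ae_of_all _ fun z => ?_)
    rw [norm_mul, norm_mul, Real.norm_of_nonneg (sq_nonneg ‖z.1‖), mul_assoc]
    refine mul_le_mul_of_nonneg_left ?_ (sq_nonneg _)
    rw [← sq_abs, pow_two]
    exact mul_le_mul_of_nonneg_left (hηle _) (abs_nonneg _)
  have hle : ∫ z, ‖deriv ψ (v z) • G z‖ ^ 2 ∂(halfMeasure N) ≤ ∫ x, f x (u x) * η (u x) := by
    rw [← heq]
    refine integral_mono hGψ (hGψ.add hw) fun z => ?_
    have := mul_nonneg (sq_nonneg ‖z.1‖) (hηpos (v z))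
    linarith
  have hleft : eLpNorm (fun z => deriv ψ (v z) • G z) 2 (halfMeasure N) ^ 2
      = ENNReal.ofReal (∫ z, ‖deriv ψ (v z) • G z‖ ^ 2 ∂(halfMeasure N)) := by
    rw [eLpNorm_two_sq, ofReal_integral_eq_lintegral_ofReal hGψ (ae_of_all _ fun z => sq_nonneg _)]
    refine lintegral_congr fun z => ?_
    rw [ENNReal.ofReal_pow (norm_nonneg _), ofReal_norm]
  rw [hleft]
  refine (ENNReal.ofReal_le_ofReal (hle.trans (le_abs_self _))).trans ?_
  rw [← Real.norm_eq_abs, ofReal_norm]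
  refine (enorm_integral_le_lintegral_enorm _).trans (lintegral_mono fun x => ?_)
  by_cases hx : m < |u x|
  · rw [Set.indicator_of_mem (show x ∈ {x | m < |u x|} from hx)]
    have hux : 0 < |u x| := hm.trans hx
    rw [← ofReal_norm, ← ofReal_norm, Real.norm_eq_abs (u x),
      ENNReal.ofReal_rpow_of_pos hux]
    refine ENNReal.ofReal_le_ofReal ?_
    rw [norm_mul]
    calc |f x (u x)| * |η (u x)| ≤ |u x| ^ (θ - 1) * |u x| :=
          mul_le_mul (hf _ _ hx) (hηle _) (abs_nonneg _) (by positivity)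
      _ = |u x| ^ θ := by rw [← Real.rpow_add_one hux.ne']; congr 1; ring
  · rw [hηm _ (not_lt.1 hx)]
    simp

end Energy

/-! ### Boundedness of the trace -/

section Bounded

variable {N : ℕ}

/-- The growth condition is only available above some level `M`: for intermediate `t` the values
`f x t` need not be bounded in `x`. -/
theorem CondF2.exists_growth {f : EuclideanSpace ℝ (Fin N) → ℝ → ℝ} (hf : CondF2 f) :
    ∃ θ M : ℝ, 2 < θ ∧ θ < 2 * (N : ℝ) / ((N : ℝ) - 1) ∧
      ∀ t x, M < |t| → |f x t| ≤ |t| ^ (θ - 1) := by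
  obtain ⟨θ, h1, h2, hlim⟩ := hf
  have hev := Metric.tendstoUniformly_iff.1 hlim 1 one_pos
  rw [eventually_comap] at hev
  obtain ⟨M, hM⟩ := eventually_atTop.1 hev
  refine ⟨θ, max M 0, h1, h2, fun t x ht => ?_⟩
  have h0 : 0 < |t| := (le_max_right _ _).trans_lt ht
  have h := hM |t| ((le_max_left _ _).trans ht.le) t rfl x
  have hp : 0 < |t| ^ (θ - 1) := Real.rpow_pos_of_pos h0 _
  rw [dist_zero_left, Real.norm_of_nonneg (by positivity), div_lt_one hp] at h
  exact h.le

theorem exists_ae_bound_trace (hN : 2 ≤ N) {f : EuclideanSpace ℝ (Fin N) → ℝ → ℝ}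
    (hf : CondF2 f) {v : Pt N → ℝ} (hv : IsWeakSolution f v) {G : Pt N → Vec N}
    {u : EuclideanSpace ℝ (Fin N) → ℝ} (h : IsSmoothLimit v G u) :
    ∃ K : ℝ, ∀ᵐ x, ‖u x‖ ≤ K := by
  obtain ⟨θ, M, hθ, hθq, hgrowth⟩ := hf.exists_growth
  obtain ⟨C, hC, htr⟩ := exists_trace_inequality_of_isSmoothLimit hN
  set q : ℝ := 2 * (N : ℝ) / ((N : ℝ) - 1) with hq
  have hq2 : 2 < q := hθ.trans hθq
  have hq0 : 0 < q := by linarith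
  have htr' : ∀ {v : Pt N → ℝ} {G : Pt N → Vec N} {u : EuclideanSpace ℝ (Fin N) → ℝ},
      IsSmoothLimit v G u →
        ∫⁻ x, ‖u x‖ₑ ^ q ≤ C ^ q * (eLpNorm G 2 (halfMeasure N) ^ 2) ^ (q / 2) := by
    intro v G u h
    have h1 := htr v G u h
    rw [eLpNorm_eq_lintegral_rpow_enorm_toReal (by simpa using hq0) (by simp),
      ENNReal.toReal_ofReal hq0.le] at h1
    have h2 := ENNReal.rpow_le_rpow h1 hq0.le
    rw [← ENNReal.rpow_mul, one_div_mul_cancel hq0.ne', ENNReal.rpow_one,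
      ENNReal.mul_rpow_of_nonneg _ _ hq0.le] at h2
    refine h2.trans (le_of_eq ?_)
    rw [← ENNReal.rpow_natCast, ← ENNReal.rpow_mul]
    congr 2
    push_cast; ring
  refine exists_ae_bound_of_levels (θ := θ) (M := M) (C := C ^ q) h.aesm_trace hq2 (by linarith)
    hθq (by finiteness) ?_ fun m k hm hMm hmk => ?_
  · have hGf := h.isWeakGrad.memLp_grad.eLpNorm_ne_top
    have : 0 ≤ q / 2 := by linarith
    exact ne_top_of_le_ne_top (by finiteness) (htr' h)
  · obtain ⟨ψ, η, hψ, hη, hψ0, hη0, hψ1, hηψ, hψk, hηle, hηpos, hηm⟩ := exists_truncation hm hmk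
    have he := eLpNorm_grad_truncation_sq_le hv h hm
      (fun t x ht => hgrowth t x (hMm.trans_lt ht)) hψ hη hη0 hψ1 hηψ hηle hηpos hηm
    calc ∫⁻ x, ENNReal.ofReal (|u x| - k) ^ q ≤ ∫⁻ x, ‖ψ (u x)‖ₑ ^ q := by
          refine lintegral_mono fun x => ENNReal.rpow_le_rpow ?_ hq0.le
          rw [← ofReal_norm]
          exact ENNReal.ofReal_le_ofReal (hψk _)
      _ ≤ _ := htr' (h.comp hψ hψ0 hψ1)
      _ ≤ _ := mul_le_mul_right (ENNReal.rpow_le_rpow he (by linarith)) _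

end Bounded

end HarmonicExtension

theorem theorem1p3 (N : ℕ) (hN : 2 ≤ N)
    (f : EuclideanSpace ℝ (Fin N) → ℝ → ℝ)
    (hf : ContDiff ℝ 1 (fun q : EuclideanSpace ℝ (Fin N) × ℝ => f q.1 q.2))
    (hf1 : HarmonicExtension.CondF1 f) (hf2 : HarmonicExtension.CondF2 f)
    (v : EuclideanSpace ℝ (Fin N) × ℝ → ℝ) (hv : HarmonicExtension.IsWeakSolution f v) :
    (∃ u : EuclideanSpace ℝ (Fin N) → ℝ, HarmonicExtension.IsTrace v u) ∧
    ∀ u : EuclideanSpace ℝ (Fin N) → ℝ, HarmonicExtension.IsTrace v u →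
      ∀ p : ℝ≥0∞, 2 ≤ p → MemLp u p volume := by
  obtain ⟨G, hG, _⟩ := hv.1
  refine ⟨hG.exists_isTrace, fun u hu p hp => ?_⟩
  obtain ⟨G, hG⟩ := hu.exists_isSmoothLimit
  obtain ⟨K, hK⟩ := HarmonicExtension.exists_ae_bound_trace hN hf2 hv hG
  exact HarmonicExtension.memLp_of_memLp_two_of_ae_bound hG.memLp_trace hK hp
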